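/- **Setting.** Let $\Bbbk\in\{\mathbb R,\mathbb C\}$ be the field of the time variables and $\mathbb K\in\{\mathbb R,\mathbb C\}$, with $\Bbbk\subseteq\mathbb K$, the field of values. Write $t=(t_1,t_3,t_5,\dots)\in\Bbbk^{\infty}$ for sequences with only finitely many nonzero entries, $x=t_1$, $\partial=\partial/\partial x$. Let $U$ be a set of such sequences that meets every line parallel to a coordinate axis in an open set. Pseudo-differential operators $P=\sum_{i\le N}p_i\partial^i$ are multiplied by the rule $\partial^i f=\sum_{k\ge0}\binom{i}{k}f^{(k)}\partial^{i-k}$ ($i\in\mathbb Z$); $P_-=\sum_{i<0}p_i\partial^i$, and the formal adjoint is $P^*=\sum_i(-1)^i\partial^i p_i$. Let $\phi=1+\sum_{i\ge1}w_i(t)\,\partial^{-i}$ be a wave operator of the CKP hierarchy on $U$: the functions $w_i:U\to\mathbb K$ are smooth in $x$ (holomorphic if $\Bbbk=\mathbb C$), $\phi^*=\phi^{-1}$, and with $L=\phi\,\partial\,\phi^{-1}$ $$\frac{\partial\phi}{\partial t_{2n+1}}=-(L^{2n+1})_-\,\phi\qquad(n=0,1,2,\dots).$$ Put $\xi(t,\lambda)=\sum_{i\ge0}t_{2i+1}\lambda^{2i+1}$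 and $\Gamma=\sum_{i\ge0}(2i+1)t_{2i+1}\partial^{2i}$ (finite sums), and let $$M=\phi\,\Gamma\,\phi^{-1},\qquad w(t,z)=\phi\,e^{\xi(t,z)}=\Big(1+\sum_{i\ge1}w_i(t)z^{-i}\Big)e^{\xi(t,z)},$$ $$A_{m,n}=M^mL^n-(-1)^nL^nM^m\qquad(m\ge0,\ n\in\mathbb Z).$$ The generating function of the additional symmetries is $$Y^C(\lambda,\mu)=\sum_{m=0}^\infty\frac{(\mu-\lambda)^m}{m!}\sum_{l=-\infty}^{\infty}\lambda^{-l-m-1}\,(A_{m,m+l})_- .$$ **Formal meaning.** All identities are at each fixed value of $(t_3,t_5,\dots)$, as operators in $x$. Here $\mu=\lambda+\varepsilon$ with a formal variable $\varepsilon$, and everything is expanded in powers of $\varepsilon=\mu-\lambda$. For given $j$ and $m$, the coefficient of $\partial^{j}\varepsilon^m$ in $Y^C$ involves only powers of $\lambda$ that are bounded above, so it is a Laurent series in $\lambda^{-1}$. The expressions $w(t,\mu)=w(t,\lambda+\varepsilon)$ and $w(t,-\lambda)$ are elements $f\,e^{\xi(t,\lambda)}$, respectively $g\,e^{-\xi(t,\lambda)}$,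 where $f,g$ are power series in $\varepsilon$ whose coefficients are Laurent series in $\lambda^{-1}$ over the functions of $x$: $(\lambda+\varepsilon)^{-i}$ is expanded by the binomial series, and $e^{\xi(t,\lambda+\varepsilon)}=e^{\xi(t,\lambda+\varepsilon)-\xi(t,\lambda)}\,e^{\xi(t,\lambda)}$, the first exponent being divisible by $\varepsilon$. The symbol $e^{\pm\xi(t,\lambda)}$ satisfies $\partial e^{\pm\xi(t,\lambda)}=\pm\lambda e^{\pm\xi(t,\lambda)}$ and $e^{\xi(t,\lambda)}e^{-\xi(t,\lambda)}=1$. **Statement.** For every $t\in U$, $$Y^C(\lambda,\mu)=w(t,\mu)\,\partial^{-1}\,w(t,-\lambda)+w(t,-\lambda)\,\partial^{-1}\,w(t,\mu),$$ an equality of pseudo-differential operators in $x$, where the functions $w$ act by multiplication. -/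

import Mathlib

/-! Pseudo-differential operators `∑_{i ≤ N} a_i ∂^i` over a commutative differential ring. -/

/-- A pseudo-differential operator `P = ∑ i, coeff i * ∂ ^ i`, with coefficients on the left and
only finitely many non-negative powers of `∂`. -/
@[ext]
structure PsiDO (R : Type*) [CommRing R] where
  coeff : ℤ → R
  bdd' : ∃ N : ℤ, ∀ n > N, coeff n = 0

noncomputable section

namespace PsiDO

variable {R : Type*} [CommRing R]

/-- `P` has order at most `d`. -/
def OrderLE (P : PsiDO R) (d : ℤ) : Prop := ∀ n > d, P.coeff n = 0

theorem exists_orderLE (P : PsiDO R) : ∃ d, P.OrderLE d := P.bdd'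

theorem OrderLE.mono {P : PsiDO R} {d e : ℤ} (h : P.OrderLE d) (hde : d ≤ e) : P.OrderLE e :=
  fun n hn => h n (by omega)

instance : Zero (PsiDO R) := ⟨⟨fun _ => 0, 0, fun _ _ => rfl⟩⟩

instance : Add (PsiDO R) :=
  ⟨fun P Q => ⟨fun n => P.coeff n + Q.coeff n, by
    obtain ⟨a, ha⟩ := P.bdd'
    obtain ⟨b, hb⟩ := Q.bdd'
    exact ⟨max a b, fun n hn => by rw [ha n (by omega), hb n (by omega), add_zero]⟩⟩⟩

instance : Neg (PsiDO R) :=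
  ⟨fun P => ⟨fun n => - P.coeff n, by
    obtain ⟨a, ha⟩ := P.bdd'
    exact ⟨a, fun n hn => by rw [ha n hn, neg_zero]⟩⟩⟩

/-- The monomial `a ∂ ^ i`. -/
def single (i : ℤ) (a : R) : PsiDO R :=
  ⟨fun n => if n = i then a else 0, i, fun n hn => if_neg (by omega)⟩

instance : One (PsiDO R) := ⟨single 0 1⟩

@[simp] theorem coeff_zero (n : ℤ) : (0 : PsiDO R).coeff n = 0 := rfl
@[simp] theorem coeff_add (P Q : PsiDO R) (n : ℤ) :
    (P + Q).coeff n = P.coeff n + Q.coeff n := rfl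
@[simp] theorem coeff_neg (P : PsiDO R) (n : ℤ) : (-P).coeff n = - P.coeff n := rfl
theorem coeff_single (i : ℤ) (a : R) (n : ℤ) :
    (single i a).coeff n = if n = i then a else 0 := rfl
theorem coeff_one (n : ℤ) : (1 : PsiDO R).coeff n = if n = 0 then 1 else 0 := rfl

theorem orderLE_single (i : ℤ) (a : R) : (single i a).OrderLE i := fun _ hn => if_neg (by omega)

instance : AddCommGroup (PsiDO R) where
  add_assoc P Q S := by ext n; simp [add_assoc]
  zero_add P := by ext n; simp
  add_zero P := by ext n; simp
  add_comm P Q := by ext n; simp [add_comm]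
  neg_add_cancel P := by ext n; simp
  nsmul := nsmulRec
  zsmul := zsmulRec

/-- The additive map `P ↦ P.coeff n`. -/
def coeffHom (n : ℤ) : PsiDO R →+ R := ⟨⟨fun P => P.coeff n, rfl⟩, fun _ _ => rfl⟩

theorem coeff_sum {ι : Type*} (s : Finset ι) (f : ι → PsiDO R) (n : ℤ) :
    (∑ i ∈ s, f i).coeff n = ∑ i ∈ s, (f i).coeff n :=
  map_sum (coeffHom n) f s

/-- The negative part `P_-` of an operator. -/
def negPart (P : PsiDO R) : PsiDO R :=
  ⟨fun n => if n < 0 then P.coeff n else 0, 0, fun n hn => if_neg (by omega)⟩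

theorem OrderLE.add {P Q : PsiDO R} {a : ℤ} (hP : P.OrderLE a) (hQ : Q.OrderLE a) :
    (P + Q).OrderLE a := fun n hn => by rw [coeff_add, hP n hn, hQ n hn, add_zero]

variable [Differential R]

/-- The `k`-th iterate of the derivation. -/
def iterD (k : ℕ) : R →ₗ[ℤ] R := (Differential.deriv : Derivation ℤ R R).toLinearMap ^ k

theorem iterD_zero (a : R) : iterD 0 a = a := rfl

theorem iterD_succ (k : ℕ) (a : R) : iterD (k + 1) a = Differential.deriv (iterD k a) := by
  simp [iterD, pow_succ']

theorem iterD_one (k : ℕ) : iterD k (1 : R) = if k = 0 then 1 else 0 := by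
  induction k with
  | zero => simp [iterD_zero]
  | succ k ih => rw [iterD_succ, ih]; split_ifs <;> simp_all

/-- The `(i, k)` term of the coefficient of `∂ ^ s` in `P Q`, from the generalized Leibniz rule
`∂ ^ i b = ∑ k, (i choose k) b^{(k)} ∂ ^ (i - k)`, valid for every integer `i`. -/
def mulTerm (P Q : PsiDO R) (s i : ℤ) (k : ℕ) : R :=
  Ring.choose i k • (P.coeff i * iterD k (Q.coeff (s - i + k)))

theorem mulTerm_eq_zero {P Q : PsiDO R} {a b : ℤ} (hP : P.OrderLE a) (hQ : Q.OrderLE b)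
    {s i : ℤ} {k : ℕ} (h : ¬ (i ≤ a ∧ s + k - b ≤ i)) : mulTerm P Q s i k = 0 := by
  unfold mulTerm
  by_cases h1 : i ≤ a
  · rw [hQ (s - i + k) (by omega)]; simp
  · rw [hP i (by omega)]; simp

instance : Mul (PsiDO R) :=
  ⟨fun P Q => ⟨fun s => ∑ᶠ p : ℤ × ℕ, mulTerm P Q s p.1 p.2, by
    obtain ⟨a, ha⟩ := P.exists_orderLE
    obtain ⟨b, hb⟩ := Q.exists_orderLE
    refine ⟨a + b, fun n hn => ?_⟩
    rw [← finsum_zero (α := ℤ × ℕ)]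
    exact finsum_congr fun p => mulTerm_eq_zero ha hb (by omega)⟩⟩

theorem coeff_mul_def (P Q : PsiDO R) (s : ℤ) :
    (P * Q).coeff s = ∑ᶠ p : ℤ × ℕ, mulTerm P Q s p.1 p.2 := rfl

theorem coeff_mul_eq_sum {P Q : PsiDO R} {a b : ℤ} (hP : P.OrderLE a) (hQ : Q.OrderLE b) (s : ℤ)
    (I : Finset ℤ) (K : ℕ) (hI : ∀ i, s - b ≤ i → i ≤ a → i ∈ I) (hK : a + b - s < K) :
    (P * Q).coeff s = ∑ i ∈ I, ∑ k ∈ Finset.range K, mulTerm P Q s i k := by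
  rw [coeff_mul_def, finsum_eq_sum_of_support_subset (s := I ×ˢ Finset.range K),
    Finset.sum_product]
  intro p hp
  have h : p.1 ≤ a ∧ s + p.2 - b ≤ p.1 := by
    by_contra h
    exact hp (mulTerm_eq_zero hP hQ h)
  simp only [Finset.coe_product, Set.mem_prod, Finset.mem_coe, Finset.mem_range]
  exact ⟨hI _ (by omega) h.1, by omega⟩

theorem OrderLE.mul {P Q : PsiDO R} {a b : ℤ} (hP : P.OrderLE a) (hQ : Q.OrderLE b) :
    (P * Q).OrderLE (a + b) := by
  intro n hn
  rw [coeff_mul_def, ← finsum_zero (α := ℤ × ℕ)]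
  exact finsum_congr fun p => mulTerm_eq_zero hP hQ (by omega)

protected theorem add_mul (P Q S : PsiDO R) : (P + Q) * S = P * S + Q * S := by
  obtain ⟨a, ha⟩ := P.exists_orderLE
  obtain ⟨b, hb⟩ := Q.exists_orderLE
  obtain ⟨c, hc⟩ := S.exists_orderLE
  have ha := ha.mono (le_max_left a b)
  have hb := hb.mono (le_max_right a b)
  ext s
  have hI : ∀ i, s - c ≤ i → i ≤ max a b → i ∈ Finset.Icc (s - c) (max a b) :=
    fun i h1 h2 => Finset.mem_Icc.2 ⟨h1, h2⟩
  have hK : max a b + c - s < ((max a b + c - s + 1).toNat : ℕ) := by omega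
  rw [coeff_add, coeff_mul_eq_sum (ha.add hb) hc s _ _ hI hK, coeff_mul_eq_sum ha hc s _ _ hI hK,
    coeff_mul_eq_sum hb hc s _ _ hI hK]
  simp only [← Finset.sum_add_distrib]
  refine Finset.sum_congr rfl fun i _ => Finset.sum_congr rfl fun k _ => ?_
  simp only [mulTerm, coeff_add, add_mul, smul_add]

protected theorem mul_add (P Q S : PsiDO R) : P * (Q + S) = P * Q + P * S := by
  obtain ⟨a, ha⟩ := P.exists_orderLE
  obtain ⟨b, hb⟩ := Q.exists_orderLE
  obtain ⟨c, hc⟩ := S.exists_orderLE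
  have hb := hb.mono (le_max_left b c)
  have hc := hc.mono (le_max_right b c)
  ext s
  have hI : ∀ i, s - max b c ≤ i → i ≤ a → i ∈ Finset.Icc (s - max b c) a :=
    fun i h1 h2 => Finset.mem_Icc.2 ⟨h1, h2⟩
  have hK : a + max b c - s < ((a + max b c - s + 1).toNat : ℕ) := by omega
  rw [coeff_add, coeff_mul_eq_sum ha (hb.add hc) s _ _ hI hK, coeff_mul_eq_sum ha hb s _ _ hI hK,
    coeff_mul_eq_sum ha hc s _ _ hI hK]
  simp only [← Finset.sum_add_distrib]
  refine Finset.sum_congr rfl fun i _ => Finset.sum_congr rfl fun k _ => ?_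
  simp only [mulTerm, coeff_add, map_add, mul_add, smul_add]

protected theorem zero_mul (P : PsiDO R) : 0 * P = 0 := by
  have h := PsiDO.add_mul 0 0 P
  rw [add_zero] at h
  exact left_eq_add.1 h

protected theorem mul_zero (P : PsiDO R) : P * 0 = 0 := by
  have h := PsiDO.mul_add P 0 0
  rw [add_zero] at h
  exact left_eq_add.1 h

theorem coeff_single_mul (i : ℤ) (a : R) {Q : PsiDO R} {b : ℤ} (hQ : Q.OrderLE b) (s : ℤ) (K : ℕ)
    (hK : i + b - s < K) :
    (single i a * Q).coeff s =
      ∑ k ∈ Finset.range K, Ring.choose i k • (a * iterD k (Q.coeff (s - i + k))) := by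
  rw [coeff_mul_eq_sum (orderLE_single i a) hQ s (insert i (Finset.Icc (s - b) i)) K
    (fun j h1 h2 => by simp [h1, h2]) hK, Finset.sum_eq_single i]
  · simp [mulTerm, coeff_single]
  · intro j _ hj
    simp [mulTerm, coeff_single, hj]
  · simp

theorem coeff_C_mul (a : R) (Q : PsiDO R) (s : ℤ) :
    (single 0 a * Q).coeff s = a * Q.coeff s := by
  obtain ⟨b, hb⟩ := Q.exists_orderLE
  rw [coeff_single_mul 0 a hb s ((b - s).toNat + 1) (by omega), Finset.sum_range_succ']
  simp [Ring.choose_zero_succ, iterD_zero]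

theorem coeff_D_mul (Q : PsiDO R) (s : ℤ) :
    (single 1 1 * Q).coeff s = Q.coeff (s - 1) + Differential.deriv (Q.coeff s) := by
  obtain ⟨b, hb⟩ := Q.exists_orderLE
  rw [coeff_single_mul 1 1 hb s ((b - s).toNat + 2) (by omega), Finset.sum_range_succ',
    Finset.sum_range_succ']
  have h (k : ℕ) : Ring.choose (1 : ℤ) (k + 1 + 1) = 0 := by
    have := Ring.choose_natCast (R := ℤ) 1 (k + 1 + 1)
    rw [Nat.choose_eq_zero_of_lt (by omega)] at this
    simpa using this
  simp [h, iterD_zero, iterD_succ]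
  ring

protected theorem one_mul (P : PsiDO R) : 1 * P = P := by
  ext s
  exact (coeff_C_mul 1 P s).trans (one_mul _)

protected theorem mul_one (P : PsiDO R) : P * 1 = P := by
  obtain ⟨a, ha⟩ := P.exists_orderLE
  ext s
  rw [show (1 : PsiDO R) = single 0 1 from rfl,
    coeff_mul_eq_sum ha (orderLE_single 0 (1 : R)) s (insert s (Finset.Icc s a))
    ((a - s).toNat + 1) (fun i h1 h2 => by simp; omega) (by omega), Finset.sum_eq_single s,
    Finset.sum_range_succ', Finset.sum_eq_zero]
  · simp [mulTerm, coeff_single, iterD_zero]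
  · intro k _
    have : ((k : ℤ) + 1) ≠ 0 := by omega
    simp [mulTerm, coeff_single, this]
  · intro i _ hi
    refine Finset.sum_eq_zero fun k _ => ?_
    simp only [mulTerm, coeff_single]
    split_ifs with h
    · rw [iterD_one, if_neg (by omega)]; simp
    · simp
  · simp

theorem D_mul_mul (X Y : PsiDO R) : single 1 1 * (X * Y) = (single 1 1 * X) * Y := by
  obtain ⟨a, ha⟩ := X.exists_orderLE
  obtain ⟨b, hb⟩ := Y.exists_orderLE
  let S : PsiDO R := ⟨fun n => X.coeff (n - 1), a + 1, fun n hn => ha _ (by omega)⟩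
  let X' : PsiDO R := ⟨fun n => Differential.deriv (X.coeff n), a, fun n hn => by
    rw [ha _ hn, map_zero]⟩
  have hS : S.OrderLE (a + 1) := fun n hn => ha _ (by omega)
  have hX' : X'.OrderLE a := fun n hn => by
    change Differential.deriv (X.coeff n) = 0
    rw [ha _ hn, map_zero]
  have hsum : single 1 1 * X = S + X' := by
    ext s; exact coeff_D_mul X s
  rw [hsum, PsiDO.add_mul]
  ext s
  rw [coeff_D_mul, coeff_add]
  let I := Finset.Icc (s - b - 1) a
  have hI : ∀ i, s - b - 1 ≤ i → i ≤ a → i ∈ I := fun i h1 h2 => Finset.mem_Icc.2 ⟨h1, h2⟩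
  let K := (a + b - s + 1).toNat
  have hK : a + b - s < K := by omega
  rw [coeff_mul_eq_sum ha hb s I K (fun i _ _ => hI i (by omega) (by omega)) hK,
    coeff_mul_eq_sum ha hb (s - 1) I (K + 1) (fun i _ _ => hI i (by omega) (by omega))
      (by push_cast; omega),
    coeff_mul_eq_sum hX' hb s I K (fun i _ _ => hI i (by omega) (by omega)) hK,
    coeff_mul_eq_sum hS hb s (I.map (addRightEmbedding 1)) (K + 1)
      (fun i _ _ => Finset.mem_map.2 ⟨i - 1, hI _ (by omega) (by omega), by simp⟩)
      (by push_cast; omega),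
    Finset.sum_map, map_sum, ← Finset.sum_add_distrib, ← Finset.sum_add_distrib]
  refine Finset.sum_congr rfl fun i _ => ?_
  rw [Finset.sum_range_succ', Finset.sum_range_succ' _ K, map_sum]
  have e0 : mulTerm X Y (s - 1) i 0 = mulTerm S Y s (addRightEmbedding 1 i) 0 := by
    simp [mulTerm, S, show s - 1 - i = s - (i + 1) by ring]
  rw [e0, add_right_comm, add_right_comm _ _ (∑ k ∈ Finset.range K, mulTerm X' Y s i k),
    ← Finset.sum_add_distrib, ← Finset.sum_add_distrib]
  congr 1
  refine Finset.sum_congr rfl fun k _ => ?_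
  simp only [mulTerm, S, X', addRightEmbedding_apply, Ring.choose_succ_succ, map_zsmul,
    Derivation.leibniz, add_sub_cancel_right, iterD_succ, smul_eq_mul]
  rw [show s - 1 - i + ((k + 1 : ℕ) : ℤ) = s - i + k by push_cast; ring,
    show s - (i + 1) + ((k + 1 : ℕ) : ℤ) = s - i + k by push_cast; ring]
  simp only [zsmul_eq_mul]
  push_cast
  ring

theorem D_mul_injective {X Y : PsiDO R} (h : single 1 1 * X = single 1 1 * Y) : X = Y := by
  obtain ⟨a, ha⟩ := X.exists_orderLE
  obtain ⟨b, hb⟩ := Y.exists_orderLE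
  have key : ∀ n : ℕ, X.coeff (max a b + 1 - n) = Y.coeff (max a b + 1 - n) := by
    intro n
    induction n with
    | zero => rw [ha _ (by push_cast; omega), hb _ (by push_cast; omega)]
    | succ n ih =>
      have e := congrArg (fun Z => Z.coeff (max a b + 1 - n)) h
      simp only [coeff_D_mul, ih] at e
      rw [show max a b + 1 - ((n + 1 : ℕ) : ℤ) = max a b + 1 - n - 1 by push_cast; ring]
      exact add_right_cancel e
  ext s
  by_cases hs : s ≤ max a b
  · have := key (max a b + 1 - s).toNat
    rwa [show max a b + 1 - ((max a b + 1 - s).toNat : ℤ) = s by omega] at this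
  · rw [ha _ (by omega), hb _ (by omega)]

theorem single_one_mul_single_one (i j : ℤ) :
    single i (1 : R) * single j 1 = single (i + j) 1 := by
  ext s
  rw [coeff_single_mul i 1 (orderLE_single j 1) s ((i + j - s).toNat + 1) (by omega),
    Finset.sum_range_succ', Finset.sum_eq_zero]
  · simp only [coeff_single, iterD_zero, Ring.choose_zero_right]
    by_cases h : s = i + j
    · rw [if_pos (by push_cast; omega), if_pos h]; simp
    · rw [if_neg (by push_cast; omega), if_neg h]; simp
  · intro k _
    simp only [coeff_single]
    split_ifs <;> simp [iterD_one]

theorem single_one_mul_assoc (i : ℤ) (Q S : PsiDO R) :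
    (single i 1 * Q) * S = single i 1 * (Q * S) := by
  induction i using Int.induction_on with
  | zero => exact (congrArg (· * S) (PsiDO.one_mul Q)).trans (PsiDO.one_mul _).symm
  | succ i ih =>
    rw [show single ((i : ℤ) + 1) (1 : R) = single 1 1 * single i 1 by
      rw [single_one_mul_single_one, add_comm], ← D_mul_mul, ← D_mul_mul, ← D_mul_mul, ih]
  | pred i ih =>
    refine D_mul_injective ?_
    have h : single 1 1 * single (-(i : ℤ) - 1) (1 : R) = single (-i) 1 := by
      rw [single_one_mul_single_one]; congr 1; ring
    rw [D_mul_mul, D_mul_mul, D_mul_mul, h, ih]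

theorem C_mul_mul (a : R) (Q S : PsiDO R) :
    (single 0 a * Q) * S = single 0 a * (Q * S) := by
  obtain ⟨b, hb⟩ := Q.exists_orderLE
  obtain ⟨c, hc⟩ := S.exists_orderLE
  have h : (single 0 a * Q).OrderLE b := by
    simpa using (orderLE_single 0 a).mul hb
  ext s
  have hI : ∀ i, s - c ≤ i → i ≤ b → i ∈ Finset.Icc (s - c) b :=
    fun i h1 h2 => Finset.mem_Icc.2 ⟨h1, h2⟩
  have hK : b + c - s < ((b + c - s + 1).toNat : ℕ) := by omega
  rw [coeff_C_mul, coeff_mul_eq_sum h hc s _ _ hI hK, coeff_mul_eq_sum hb hc s _ _ hI hK,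
    Finset.mul_sum]
  refine Finset.sum_congr rfl fun i _ => ?_
  rw [Finset.mul_sum]
  refine Finset.sum_congr rfl fun k _ => ?_
  simp only [mulTerm, coeff_C_mul, zsmul_eq_mul]
  ring

theorem single_mul_assoc (i : ℤ) (a : R) (Q S : PsiDO R) :
    (single i a * Q) * S = single i a * (Q * S) := by
  have h : single i a = single 0 a * single i 1 := by
    ext s; rw [coeff_C_mul]; simp [coeff_single]
  rw [h, C_mul_mul, C_mul_mul, C_mul_mul, single_one_mul_assoc]

theorem sum_single_mul {ι : Type*} (I : Finset ι) (e : ι → ℤ) (f : ι → R) (Q : PsiDO R) :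
    (∑ i ∈ I, single (e i) (f i)) * Q = ∑ i ∈ I, single (e i) (f i) * Q := by
  classical
  induction I using Finset.induction_on with
  | empty => simp [PsiDO.zero_mul]
  | insert i I hi ih => rw [Finset.sum_insert hi, Finset.sum_insert hi, PsiDO.add_mul, ih]

protected theorem mul_assoc (P Q S : PsiDO R) : (P * Q) * S = P * (Q * S) := by
  obtain ⟨a, ha⟩ := P.exists_orderLE
  obtain ⟨b, hb⟩ := Q.exists_orderLE
  obtain ⟨c, hc⟩ := S.exists_orderLE
  ext s
  let l : ℤ := s - b - c
  let low : PsiDO R := ⟨fun n => if n < l then P.coeff n else 0, l, fun n hn => if_neg (by omega)⟩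
  have hlow : low.OrderLE (l - 1) := fun n hn => if_neg (by omega)
  have hP : P = (∑ i ∈ Finset.Icc l a, single i (P.coeff i)) + low := by
    ext n
    rw [coeff_add, coeff_sum]
    simp only [coeff_single, Finset.sum_ite_eq, Finset.mem_Icc, low]
    split_ifs with h1 h2 h2
    · omega
    · simp
    · simp
    · rw [ha n (by omega)]; simp
  have h1 : ((low * Q) * S).coeff s = 0 := (hlow.mul hb).mul hc s (by omega)
  have h2 : (low * (Q * S)).coeff s = 0 := hlow.mul (hb.mul hc) s (by omega)
  rw [hP, PsiDO.add_mul, PsiDO.add_mul, PsiDO.add_mul, coeff_add, coeff_add, h1, h2,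
    sum_single_mul _ (fun i => i), sum_single_mul _ (fun i => i)]
  congr 2
  have hs : ∀ I : Finset ℤ, (∑ i ∈ I, single i (P.coeff i) * Q) * S =
      ∑ i ∈ I, (single i (P.coeff i) * Q) * S := by
    intro I
    induction I using Finset.induction_on with
    | empty => simp [PsiDO.zero_mul]
    | insert i I hi ih => rw [Finset.sum_insert hi, Finset.sum_insert hi, PsiDO.add_mul, ih]
  rw [hs]
  exact Finset.sum_congr rfl fun i _ => single_mul_assoc i _ Q S

instance : Ring (PsiDO R) where
  __ := (inferInstance : AddCommGroup (PsiDO R))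
  mul_assoc := PsiDO.mul_assoc
  one_mul := PsiDO.one_mul
  mul_one := PsiDO.mul_one
  left_distrib := PsiDO.mul_add
  right_distrib := PsiDO.add_mul
  zero_mul := PsiDO.zero_mul
  mul_zero := PsiDO.mul_zero

/-- The formal adjoint `P^* = ∑ i, (-1)^i ∂^i p_i` of `P = ∑ i, p_i ∂^i`, expanded with the
coefficients on the left. -/
def adjoint (P : PsiDO R) : PsiDO R :=
  ⟨fun s => ∑ᶠ k : ℕ,
      ((Int.negOnePow (s + k) : ℤ) * Ring.choose (s + k) k) • iterD k (P.coeff (s + k)), by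
    obtain ⟨a, ha⟩ := P.exists_orderLE
    refine ⟨a, fun n hn => ?_⟩
    rw [← finsum_zero (α := ℕ)]
    exact finsum_congr fun k => by rw [ha _ (by omega)]; simp⟩

theorem OrderLE.adjoint {P : PsiDO R} {a : ℤ} (hP : P.OrderLE a) : P.adjoint.OrderLE a := by
  intro n hn
  change ∑ᶠ k : ℕ, _ = _
  rw [← finsum_zero (α := ℕ)]
  exact finsum_congr fun k => by rw [hP _ (by omega)]; simp

/-- The invertible operator `∂`. -/
def D : (PsiDO R)ˣ where
  val := single 1 1
  inv := single (-1) 1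
  val_inv := single_one_mul_single_one 1 (-1)
  inv_val := single_one_mul_single_one (-1) 1

end PsiDO

/-! The formal ring in which wave functions, expanded in `ε = μ - λ`, live. -/

namespace Wave

/-- A derivation given by an additive map that satisfies the Leibniz rule. -/
abbrev mkDifferential {S : Type*} [CommRing S] (d : S →+ S)
    (h : ∀ f g, d (f * g) = f * d g + g * d f) : Differential S where
  deriv := Derivation.mk' d.toIntLinearMap h

/-- The derivation of a differential ring as an additive map. -/
def dHom (S : Type*) [CommRing S] [Differential S] : S →+ S :=
  (Differential.deriv : Derivation ℤ S S).toLinearMap.toAddMonoidHom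

theorem dHom_mul {S : Type*} [CommRing S] [Differential S] (f g : S) :
    dHom S (f * g) = f * dHom S g + g * dHom S f :=
  (Differential.deriv : Derivation ℤ S S).leibniz f g

variable {R : Type*} [CommRing R]

/-- Coefficientwise derivation on Laurent series. -/
instance instDifferentialLaurentSeries [Differential R] : Differential (LaurentSeries R) :=
  mkDifferential
    { toFun := fun f => HahnSeries.map f (dHom R)
      map_zero' := by ext; simp
      map_add' := fun f g => by ext; simp }
    (by
      intro f g
      ext a
      have hf : (HahnSeries.map f (dHom R)).support ⊆ f.support :=
        Function.support_comp_subset (map_zero _) _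
      have hg : (HahnSeries.map g (dHom R)).support ⊆ g.support :=
        Function.support_comp_subset (map_zero _) _
      simp only [AddMonoidHom.coe_mk, ZeroHom.coe_mk, HahnSeries.coeff_add, HahnSeries.map_coeff]
      rw [mul_comm g, HahnSeries.coeff_mul, HahnSeries.coeff_mul_left' f.isPWO_support hf,
        HahnSeries.coeff_mul_right' g.isPWO_support hg, map_sum, ← Finset.sum_add_distrib]
      refine Finset.sum_congr rfl fun ij _ => ?_
      simp only [HahnSeries.map_coeff, dHom_mul]
      ring)

/-- Coefficientwise derivation on power series. -/
instance instDifferentialPowerSeries [Differential R] : Differential (PowerSeries R) :=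
  mkDifferential
    { toFun := fun f => PowerSeries.mk fun n => dHom R (PowerSeries.coeff n f)
      map_zero' := by ext; simp
      map_add' := fun f g => by ext; simp }
    (by
      intro f g
      ext n
      simp only [AddMonoidHom.coe_mk, ZeroHom.coe_mk, map_add, PowerSeries.coeff_mk]
      rw [mul_comm g, PowerSeries.coeff_mul, PowerSeries.coeff_mul, PowerSeries.coeff_mul, map_sum,
        ← Finset.sum_add_distrib]
      refine Finset.sum_congr rfl fun ij _ => ?_
      simp only [PowerSeries.coeff_mk, dHom_mul]
      ring)

/-- The derivation on `S[T;T⁻¹]` that extends the derivation of `S` and satisfies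
`(T k)′ = k c T k`: the coefficient of `T k` in `f′` is `(f_k)′ + k c f_k`. -/
abbrev expDifferential (S : Type*) [CommRing S] [Differential S] (c : S) :
    Differential (LaurentPolynomial S) :=
  mkDifferential
    { toFun := fun f => AddMonoidAlgebra.ofCoeff
        (f.coeff.mapRange (dHom S) (map_zero _) +
          Finsupp.onFinset f.coeff.support (fun k => (k : S) * c * f.coeff k)
            (fun k hk => by
              rw [Finsupp.mem_support_iff]
              intro h
              exact hk (by rw [h, mul_zero])))
      map_zero' := by ext k : 1; simp
      map_add' := fun f g => by
        ext k : 1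
        simp only [AddMonoidAlgebra.coeff_add, Finsupp.add_apply, Finsupp.mapRange_apply,
          Finsupp.onFinset_apply, map_add, mul_add]
        ring }
    (by
      intro f g
      induction f using LaurentPolynomial.induction_on' with
      | add p q hp hq => rw [add_mul, map_add, hp, hq, map_add]; ring
      | C_mul_T i a =>
        induction g using LaurentPolynomial.induction_on' with
        | add p q hp hq => rw [mul_add, map_add, hp, hq, map_add]; ring
        | C_mul_T j b =>
          have key : ∀ (i : ℤ) (a : S), AddMonoidAlgebra.ofCoeff
              ((AddMonoidAlgebra.single i a).coeff.mapRange (dHom S) (map_zero _) +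
                Finsupp.onFinset (AddMonoidAlgebra.single i a).coeff.support
                  (fun k => (k : S) * c * (AddMonoidAlgebra.single i a).coeff k)
                  (fun k hk => by
                    rw [Finsupp.mem_support_iff]
                    intro h
                    exact hk (by rw [h, mul_zero]))) =
              AddMonoidAlgebra.single i (dHom S a + (i : S) * c * a) := by
            intro i a
            ext k : 1
            simp only [Finsupp.add_apply, Finsupp.mapRange_apply,
              Finsupp.onFinset_apply, AddMonoidAlgebra.coeff_single, Finsupp.single_apply]
            split_ifs with h <;> simp [h]
          simp only [AddMonoidHom.coe_mk, ZeroHom.coe_mk, ← LaurentPolynomial.single_eq_C_mul_T,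
            AddMonoidAlgebra.single_mul_single, key, dHom_mul]
          rw [add_comm j i, ← AddMonoidAlgebra.single_add]
          congr 1
          push_cast
          ring)

/-- The Laurent series with coefficients `f p`, for `f` vanishing below some index. -/
def laurentMk (f : ℤ → R) (hf : ∃ N : ℤ, ∀ p < N, f p = 0) : LaurentSeries R :=
  HahnSeries.ofSuppBddBelow f (by
    obtain ⟨N, hN⟩ := hf
    exact ⟨N, fun p hp => by
      by_contra h
      exact hp (hN p (not_le.1 h))⟩)

/-- A Laurent series vanishes below some index. -/
theorem laurent_bdd (f : LaurentSeries R) : ∃ N : ℤ, ∀ p < N, f.coeff p = 0 :=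
  ⟨f.order, fun _ hp => HahnSeries.coeff_eq_zero_of_lt_order hp⟩

/-- The spectral parameter `λ`. Here and below `LaurentSeries R` is the ring `R((λ⁻¹))`: the
coefficient with index `p` is the coefficient of `λ ^ (-p)`. -/
def lam : LaurentSeries R := HahnSeries.single (-1) 1

/-- Finite sums `∑ k, f_k e^{k ξ(t,λ)}`, where `f_k` is a power series in `ε = μ - λ` with
coefficients in `R((λ⁻¹))`. The Laurent polynomial variable `T 1` is the symbol `e^{ξ(t,λ)}`, and
`T (-1)` is `e^{-ξ(t,λ)} = e^{ξ(t,-λ)}`. -/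
abbrev WaveRing (R : Type*) [CommRing R] : Type _ :=
  LaurentPolynomial (PowerSeries (LaurentSeries R))

/-- The derivation `∂ = ∂_x` on `WaveRing R`: `λ` and `ε` are constants, and
`∂ e^{k ξ(t,λ)} = k λ e^{k ξ(t,λ)}`, because `∂_x ξ(t,λ) = λ`. -/
instance instDifferentialWaveRing [Differential R] : Differential (WaveRing R) :=
  expDifferential _ (PowerSeries.C lam)

/-- The substitution `λ ↦ μ = λ + ε`, expanded in powers of `ε`:
`λ ^ n ↦ ∑ m, (n choose m) λ ^ (n - m) ε ^ m` for every integer `n`. -/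
def shift (f : LaurentSeries R) : PowerSeries (LaurentSeries R) :=
  PowerSeries.mk fun m => laurentMk (fun p => Ring.choose ((m : ℤ) - p) m • f.coeff (p - m)) (by
    obtain ⟨N, hN⟩ := laurent_bdd f
    exact ⟨N + m, fun p hp => by rw [hN _ (by omega), smul_zero]⟩)

/-- The substitution `λ ↦ -λ`. -/
def reflect (f : LaurentSeries R) : LaurentSeries R :=
  laurentMk (fun p => (Int.negOnePow p : ℤ) • f.coeff p) (by
    obtain ⟨N, hN⟩ := laurent_bdd f
    exact ⟨N, fun p hp => by rw [hN _ hp, smul_zero]⟩)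

/-- The symbol `∑ i, p_i λ ^ i` of `P = ∑ i, p_i ∂ ^ i`; thus `P e^{ξ(t,λ)}` is the symbol of `P`
times `e^{ξ(t,λ)}`. -/
def symbol (P : PsiDO R) : LaurentSeries R :=
  laurentMk (fun p => P.coeff (-p)) (by
    obtain ⟨d, hd⟩ := P.exists_orderLE
    exact ⟨-d, fun p hp => hd _ (by omega)⟩)

/-- `ξ(t,λ) = ∑ i, t_{2i+1} λ ^ (2i+1)`, for times `τ i = t_{2i+1}` of which all but finitely
many vanish. -/
def xi (τ : ℕ →₀ R) : LaurentSeries R :=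
  τ.sum fun i a => HahnSeries.single (-(2 * (i : ℤ) + 1)) a

/-- `Γ = ∑ i, (2i+1) t_{2i+1} ∂ ^ (2i)`. -/
def Gam (τ : ℕ →₀ R) : PsiDO R :=
  τ.sum fun i a => PsiDO.single (2 * (i : ℤ)) ((2 * i + 1) • a)

/-- `ξ(t,λ+ε) - ξ(t,λ)` is divisible by `ε`, so that it can be substituted into power series. -/
theorem hasSubst_shift_xi (τ : ℕ →₀ R) :
    PowerSeries.HasSubst (shift (xi τ) - PowerSeries.C (xi τ)) := by
  apply PowerSeries.HasSubst.of_constantCoeff_zero'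
  ext p
  rw [map_sub, ← PowerSeries.coeff_zero_eq_constantCoeff_apply, shift, PowerSeries.coeff_mk]
  change Ring.choose (((0 : ℕ) : ℤ) - p) 0 • (xi τ).coeff (p - (0 : ℕ)) - _ = _
  simp

variable [Differential R]

/-- A wave operator `φ = 1 + ∑_{i ≥ 1} w_i ∂ ^ (-i)` with `φ^* = φ⁻¹`. -/
structure WaveOp (R : Type*) [CommRing R] [Differential R] where
  phi : PsiDO R
  orderLE : phi.OrderLE 0
  coeff_zero : phi.coeff 0 = 1
  phi_mul_adjoint : phi * phi.adjoint = 1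
  adjoint_mul_phi : phi.adjoint * phi = 1

namespace WaveOp

variable (W : WaveOp R)

/-- `φ` as an invertible operator, with inverse `φ⁻¹ = φ^*`. -/
def unit : (PsiDO R)ˣ := ⟨W.phi, W.phi.adjoint, W.phi_mul_adjoint, W.adjoint_mul_phi⟩

/-- The Lax operator `L = φ ∂ φ⁻¹`, an invertible operator. -/
def L : (PsiDO R)ˣ := W.unit * PsiDO.D * W.unit⁻¹

/-- The Orlov-Schulman operator `M = φ Γ φ⁻¹`. -/
def M (τ : ℕ →₀ R) : PsiDO R := (W.unit : PsiDO R) * Gam τ * ((W.unit⁻¹ : (PsiDO R)ˣ) : PsiDO R)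

/-- `A_{m,n} = M^m L^n - (-1)^n L^n M^m`, for every natural number `m` and integer `n`. -/
def A (τ : ℕ →₀ R) (m : ℕ) (n : ℤ) : PsiDO R :=
  W.M τ ^ m * ((W.L ^ n : (PsiDO R)ˣ) : PsiDO R) -
    (Int.negOnePow n : ℤ) • (((W.L ^ n : (PsiDO R)ˣ) : PsiDO R) * W.M τ ^ m)

theorem orderLE_L_zpow (n : ℤ) : ((W.L ^ n : (PsiDO R)ˣ) : PsiDO R).OrderLE n := by
  have hD : (((PsiDO.D : (PsiDO R)ˣ) ^ n : (PsiDO R)ˣ) : PsiDO R) = PsiDO.single n 1 := by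
    induction n using Int.induction_on with
    | zero => rfl
    | succ i ih =>
      rw [zpow_add_one, Units.val_mul, ih]
      exact PsiDO.single_one_mul_single_one _ _
    | pred i ih =>
      rw [zpow_sub_one, Units.val_mul, ih]
      exact PsiDO.single_one_mul_single_one _ _
  rw [L, conj_zpow, Units.val_mul, Units.val_mul, hD]
  have h := (W.orderLE.mul (PsiDO.orderLE_single n 1)).mul W.orderLE.adjoint
  rwa [zero_add, add_zero] at h

theorem exists_A_eq_zero (τ : ℕ →₀ R) (m : ℕ) (j : ℤ) :
    ∃ N : ℤ, ∀ n < N, (W.A τ m n).coeff j = 0 := by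
  obtain ⟨d, hd⟩ := (W.M τ ^ m).exists_orderLE
  refine ⟨j - d, fun n hn => ?_⟩
  have h1 := hd.mul (W.orderLE_L_zpow n) j (by omega)
  have h2 := (W.orderLE_L_zpow n).mul hd j (by omega)
  have h3 : (W.A τ m n).coeff j = _ := map_sub (PsiDO.coeffHom j) _ _
  rw [h3, map_zsmul]
  simp only [PsiDO.coeffHom, AddMonoidHom.coe_mk, ZeroHom.coe_mk]
  rw [h1, h2, smul_zero, sub_zero]

variable [Algebra ℚ R]

/-- The generating function
`Y^C(λ, μ) = ∑_{m ≥ 0} (μ - λ)^m / m! ∑_{l ∈ ℤ} λ^(-l-m-1) (A_{m,m+l})_-`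
as an operator over `WaveRing R`: its coefficient at `∂ ^ j`, `ε ^ m`, `λ ^ (-p)` comes from the
only term with `l + m + 1 = p`, that is `m + l = p - 1`. -/
def Y (τ : ℕ →₀ R) : PsiDO (WaveRing R) where
  coeff j := LaurentPolynomial.C (PowerSeries.mk fun m =>
    laurentMk (fun p => algebraMap ℚ R (1 / (m.factorial : ℚ)) *
      (W.A τ m (p - 1)).negPart.coeff j) (by
        obtain ⟨N, hN⟩ := W.exists_A_eq_zero τ m j
        refine ⟨N + 1, fun p hp => ?_⟩
        change _ * (if j < 0 then _ else _) = _
        rw [hN _ (by omega), ite_self, mul_zero]))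
  bdd' := by
    refine ⟨-1, fun j hj => ?_⟩
    rw [← map_zero LaurentPolynomial.C]
    congr 1
    ext m p
    change _ * (if j < 0 then _ else _) = _
    rw [if_neg (by omega), mul_zero]
    simp

/-- `w(t,μ) = φ e^{ξ(t,μ)} = (∑ i, w_i μ^(-i)) e^{ξ(t,μ) - ξ(t,λ)} e^{ξ(t,λ)}` with `μ = λ + ε`.
The exponent `ξ(t,λ+ε) - ξ(t,λ)` is divisible by `ε`, so that its exponential is defined. -/
def waveMu (τ : ℕ →₀ R) : WaveRing R :=
  LaurentPolynomial.C (shift (symbol W.phi) *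
    (PowerSeries.exp (LaurentSeries R)).subst (shift (xi τ) - PowerSeries.C (xi τ))) *
  LaurentPolynomial.T 1

/-- `w(t,-λ) = φ e^{ξ(t,-λ)} = (∑ i, w_i (-λ)^(-i)) e^{-ξ(t,λ)}`. -/
def waveNegLam : WaveRing R :=
  LaurentPolynomial.C (PowerSeries.C (reflect (symbol W.phi))) * LaurentPolynomial.T (-1)

end WaveOp

end Wave

/-! Smooth functions of `x` and the CKP hierarchy. -/

namespace CKP

open scoped ContDiff

section Smooth

variable {𝕜 : Type*} [RCLike 𝕜] (𝕂 : Type*) [RCLike 𝕂] [NormedAlgebra 𝕜 𝕂]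

/-- Extension of a function on an open set by zero. -/
def ext0 {V : TopologicalSpace.Opens 𝕜} {𝕂 : Type*} [RCLike 𝕂] (f : V → 𝕂) : 𝕜 → 𝕂 :=
  Function.extend Subtype.val f 0

theorem ext0_apply {V : TopologicalSpace.Opens 𝕜} {𝕂 : Type*} [RCLike 𝕂] (f : V → 𝕂) (x : V) :
    ext0 f x = f x := Subtype.val_injective.extend_apply f 0 x

/-- The algebra of smooth `𝕂`-valued functions on an open subset `V` of `𝕜` (holomorphic functions
if `𝕜 = ℂ`). -/
def smoothAlg (V : TopologicalSpace.Opens 𝕜) : Subalgebra 𝕂 (V → 𝕂) where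
  carrier := {f | ContDiffOn 𝕜 ∞ (ext0 f) V}
  mul_mem' {f g} hf hg := (hf.mul hg).congr fun x hx => by
    rw [ext0_apply (f * g) ⟨x, hx⟩, ext0_apply f ⟨x, hx⟩, ext0_apply g ⟨x, hx⟩]; rfl
  add_mem' {f g} hf hg := (hf.add hg).congr fun x hx => by
    rw [ext0_apply (f + g) ⟨x, hx⟩, ext0_apply f ⟨x, hx⟩, ext0_apply g ⟨x, hx⟩]; rfl
  algebraMap_mem' c := (contDiffOn_const (c := c)).congr fun x hx => by
    rw [ext0_apply _ ⟨x, hx⟩]; rfl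

/-- The restriction to `V` of a function that is smooth on `V`. -/
def smoothMk {V : TopologicalSpace.Opens 𝕜} {𝕂 : Type*} [RCLike 𝕂] [NormedAlgebra 𝕜 𝕂]
    (f : 𝕜 → 𝕂) (hf : ContDiffOn 𝕜 ∞ f V) : smoothAlg 𝕂 V :=
  ⟨fun x => f x, hf.congr fun x hx => ext0_apply (fun x : V => f x) ⟨x, hx⟩⟩

/-- Smooth functions on `V` with the derivation `∂ = d/dx`. -/
instance instDifferentialSmooth (V : TopologicalSpace.Opens 𝕜) :
    Differential (smoothAlg 𝕂 V) :=
  Wave.mkDifferential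
    { toFun := fun f => smoothMk (deriv (ext0 f.1))
        (f.2.deriv_of_isOpen V.isOpen (by simp))
      map_zero' := by
        ext x
        have h : ext0 (0 : V → 𝕂) = fun _ => 0 := Function.extend_zero _
        change deriv (ext0 (0 : V → 𝕂)) x = 0
        rw [h, deriv_const]
      map_add' := fun f g => by
        ext x
        have hf := (f.2.contDiffAt (V.isOpen.mem_nhds x.2)).differentiableAt (by simp)
        have hg := (g.2.contDiffAt (V.isOpen.mem_nhds x.2)).differentiableAt (by simp)
        have h : ext0 (f.1 + g.1) = ext0 f.1 + ext0 g.1 := by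
          have := Function.extend_add (Subtype.val : V → 𝕜) f.1 g.1 0 0
          rwa [add_zero] at this
        change deriv (ext0 (f.1 + g.1)) x = deriv (ext0 f.1) x + deriv (ext0 g.1) x
        rw [h, deriv_add hf hg] }
    (by
      intro f g
      ext x
      have hf := (f.2.contDiffAt (V.isOpen.mem_nhds x.2)).differentiableAt (by simp)
      have hg := (g.2.contDiffAt (V.isOpen.mem_nhds x.2)).differentiableAt (by simp)
      have h : ext0 (f.1 * g.1) = ext0 f.1 * ext0 g.1 := by
        have := Function.extend_mul (Subtype.val : V → 𝕜) f.1 g.1 0 0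
        rwa [mul_zero] at this
      change deriv (ext0 (f.1 * g.1)) x =
        f.1 x * deriv (ext0 g.1) x + g.1 x * deriv (ext0 f.1) x
      rw [h, deriv_mul hf hg, ext0_apply, ext0_apply]
      ring)

end Smooth

/-- Time variables: `t n` is `t_{2n+1}`, and `x = t 0 = t_1`. All but finitely many vanish. -/
abbrev Times (𝕜 : Type*) [RCLike 𝕜] : Type _ := ℕ →₀ 𝕜

/-- A set of times that meets every line parallel to a coordinate axis in an open set. -/
structure TimeDomain (𝕜 : Type*) [RCLike 𝕜] where
  carrier : Set (Times 𝕜)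
  isOpen_line : ∀ (t : Times 𝕜) (n : ℕ), IsOpen {s : 𝕜 | t.update n s ∈ carrier}

section Hierarchy

variable {𝕜 : Type*} [RCLike 𝕜]

/-- The range of the variable `x` when the higher times are frozen at their values in `t`. -/
def TimeDomain.slice (U : TimeDomain 𝕜) (t : Times 𝕜) : TopologicalSpace.Opens 𝕜 :=
  ⟨{x | t.update 0 x ∈ U.carrier}, U.isOpen_line t 0⟩

theorem TimeDomain.mem_slice {U : TimeDomain 𝕜} {t : Times 𝕜} (ht : t ∈ U.carrier) :
    t 0 ∈ U.slice t := by
  change t.update 0 (t 0) ∈ U.carrier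
  rwa [Finsupp.update_self]

variable (𝕂 : Type*) [RCLike 𝕂] [NormedAlgebra 𝕜 𝕂]

/-- The time variables as functions of `x`: the variable `x` itself in place `0`, and the frozen
constants `t n` in the places `n ≥ 1`. -/
def timeFunctions (U : TimeDomain 𝕜) (t : Times 𝕜) : ℕ →₀ smoothAlg 𝕂 (U.slice t) :=
  (t.mapRange (fun a => algebraMap 𝕂 (smoothAlg 𝕂 (U.slice t)) (algebraMap 𝕜 𝕂 a))
    (by simp)).update 0
    (smoothMk (fun x => algebraMap 𝕜 𝕂 x) (algebraMapCLM 𝕜 𝕂).contDiff.contDiffOn)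

/-- The operator `φ = ∑_{i ≥ 0} w_i ∂ ^ (-i)` in the variable `x`, with the higher times frozen at
their values in `t`. -/
def phiOp {U : TimeDomain 𝕜} {𝕂 : Type*} [RCLike 𝕂] [NormedAlgebra 𝕜 𝕂] (w : ℕ → Times 𝕜 → 𝕂)
    (hw : ∀ i t, ContDiffOn 𝕜 ∞ (fun x => w i (t.update 0 x)) (U.slice t)) (t : Times 𝕜) :
    PsiDO (smoothAlg 𝕂 (U.slice t)) where
  coeff n := if n ≤ 0 then smoothMk (fun x => w (-n).toNat (t.update 0 x)) (hw _ t) else 0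
  bdd' := ⟨0, fun n hn => if_neg (by omega)⟩

/-- A dressing operator `φ(t) = 1 + ∑_{i ≥ 1} w_i(t) ∂ ^ (-i)`, smooth in `x`, that satisfies the
constraint `φ^* = φ⁻¹`. -/
structure Dressing (U : TimeDomain 𝕜) where
  w : ℕ → Times 𝕜 → 𝕂
  w_zero : ∀ t ∈ U.carrier, w 0 t = 1
  smooth : ∀ i t, ContDiffOn 𝕜 ∞ (fun x => w i (t.update 0 x)) (U.slice t)
  phi_mul_adjoint : ∀ t, phiOp w smooth t * (phiOp w smooth t).adjoint = 1
  adjoint_mul_phi : ∀ t, (phiOp w smooth t).adjoint * phiOp w smooth t = 1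

namespace Dressing

variable {𝕂} {U : TimeDomain 𝕜} (Φ : Dressing 𝕂 U)

/-- The wave operator in the variable `x`, with the higher times frozen at their values in `t`. -/
def waveOp (t : Times 𝕜) : Wave.WaveOp (smoothAlg 𝕂 (U.slice t)) where
  phi := phiOp Φ.w Φ.smooth t
  orderLE := fun _ hn => if_neg (by omega)
  coeff_zero := by
    ext x
    exact Φ.w_zero _ x.2
  phi_mul_adjoint := Φ.phi_mul_adjoint t
  adjoint_mul_phi := Φ.adjoint_mul_phi t

/-- The flows `∂φ/∂t_{2n+1} = -(L^{2n+1})_- φ` of the CKP hierarchy, for all `n ≥ 0`, coefficient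
by coefficient. -/
def IsCKP : Prop :=
  ∀ (t : Times 𝕜) (ht : t ∈ U.carrier) (n i : ℕ),
    HasDerivAt (fun s : 𝕜 => Φ.w i (t.update n s))
      (((-(((Φ.waveOp t).L : PsiDO (smoothAlg 𝕂 (U.slice t))) ^ (2 * n + 1)).negPart *
        (Φ.waveOp t).phi).coeff (-(i : ℤ))).1 ⟨t 0, TimeDomain.mem_slice ht⟩)
      (t n)

/-- The generating function `Y^C(λ,μ)`, as an operator in `x` at the frozen higher times of `t`. -/
def generatingFunction (t : Times 𝕜) : PsiDO (Wave.WaveRing (smoothAlg 𝕂 (U.slice t))) :=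
  (Φ.waveOp t).Y (timeFunctions 𝕂 U t)

/-- The wave function `w(t,μ)`, as a function of `x` at the frozen higher times of `t`. -/
def waveMu (t : Times 𝕜) : Wave.WaveRing (smoothAlg 𝕂 (U.slice t)) :=
  (Φ.waveOp t).waveMu (timeFunctions 𝕂 U t)

/-- The wave function `w(t,-λ)`, as a function of `x` at the frozen higher times of `t`. -/
def waveNegLam (t : Times 𝕜) : Wave.WaveRing (smoothAlg 𝕂 (U.slice t)) :=
  (Φ.waveOp t).waveNegLam

end Dressing

end Hierarchy

end CKP

end

/-!
The identity is one of operators in `x` at frozen higher times, and it follows from the dressing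
form `L = φ ∂ φ⁻¹`, `M = φ Γ φ⁻¹` and from `φ⁻¹ = φ^*`. These give
`M^m L^n = φ Γ^m ∂^n φ^*` and `L^n M^m = φ ∂^n Γ^m φ^*`.

The main tool is the residue formula
`∑ n, λ^(-n-1) (P ∂^n Q)_- = (P e^{ξ}) ∂⁻¹ (Q^* e^{-ξ})`
(`Wave.coeff_symbol_mul_twistedD_iterate`). It holds because `∑ n, λ^(-n-1) ∂^n` behaves as a delta
function `δ(λ, ∂)`, which turns `P` on its left and `Q` on its right into their symbols, and has
negative part `(∂ - λ)⁻¹ = e^{ξ} ∂⁻¹ e^{-ξ}`. In coefficients it reduces to an induction on the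
power of `∂⁻¹`, each step of which multiplies by `∂` from the left. Adjoints enter only through
the residues of `∂^(p-1) Q`; this is the relation `PsiDO.IsFormalAdjoint`, which holds between `φ`
and `φ^*` by the Vandermonde identity, and between `φ Γ^m` and `Γ^m φ^*` because `Γ` is formally
self-adjoint.

Applied with `P = φ Γ^m`, `Q = φ^*`, the formula produces the first summand of the right-hand side;
applied with `P = φ`, `Q = Γ^m φ^*` and `λ` replaced by `-λ`, it produces the second
(`Wave.WaveOp.coeff_A`). It remains to see that `φ Γ^m e^{ξ} / m!` is the coefficient of `ε^m` in
`w(t, λ + ε)` (`Wave.factorial_smul_coeff_wave`). Right multiplication by `Γ` acts on symbols as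
`d/dλ + ξ_λ`, since `x′ = 1` and the other times are constants, and the series
`F = e^{-ξ(λ)} w(λ + ε)` satisfies the matching equation `dF/dε = (d/dλ + ξ_λ) F`.
-/

noncomputable section

/-! ### Derivations of exponentials of power series -/

namespace Wave

theorem leibniz_pow {A : Type*} [CommRing A] (D : A →+ A)
    (hD : ∀ f g, D (f * g) = f * D g + g * D f) (f : A) (n : ℕ) :
    D (f ^ n) = n * f ^ (n - 1) * D f := by
  have h := (mkDifferential D hD).deriv.leibniz_pow f n
  rw [nsmul_eq_mul, smul_eq_mul, ← mul_assoc] at h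
  exact h

theorem leibniz_one {A : Type*} [CommRing A] (D : A →+ A)
    (hD : ∀ f g, D (f * g) = f * D g + g * D f) : D 1 = 0 :=
  (mkDifferential D hD).deriv.map_one_eq_zero

end Wave

namespace PowerSeries

variable {S : Type*} [CommRing S] [Algebra ℚ S]

/-- Modulo `X ^ N`, the series `exp a` is its truncated sum: this reduces statements about `exp a`
to polynomials in `a`. -/
theorem X_pow_dvd_exp_subst_sub {a : PowerSeries S} (ha : constantCoeff a = 0) (N : ℕ) :
    X ^ N ∣ (exp S).subst a - ∑ k ∈ Finset.range N, (1 / (k.factorial : ℚ)) • a ^ k := by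
  rw [X_pow_dvd_iff]
  intro n hn
  have hpow (k : ℕ) (hk : n < k) : coeff n (a ^ k) = 0 :=
    X_pow_dvd_iff.1 (pow_dvd_pow_of_dvd (X_dvd_iff.2 ha) k) n hk
  rw [map_sub, map_sum, coeff_subst' (HasSubst.of_constantCoeff_zero' ha),
    finsum_eq_sum_of_support_subset (s := Finset.range N), sub_eq_zero]
  · refine Finset.sum_congr rfl fun k _ => ?_
    rw [coeff_exp, algebraMap_smul, map_rat_smul (coeff n : PowerSeries S →ₗ[S] S)]
  · intro k hk
    by_contra h
    exact hk (by simp only [hpow k (by simp at h; omega), smul_zero])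

theorem constantCoeff_exp_subst {a : PowerSeries S} (ha : constantCoeff a = 0) :
    constantCoeff ((exp S).subst a) = 1 := by
  obtain ⟨r, hr⟩ := X_pow_dvd_exp_subst_sub ha 1
  rw [sub_eq_iff_eq_add.1 hr]
  simp

/-- `D (exp a) = exp a * D a` for every derivation `D` of a power series ring, not only for the
derivation by the variable: since `D (X ^ N r)` is divisible by `X ^ (N - 1)`, any `D` is
continuous, and it suffices to differentiate the truncated exponential sums. -/
theorem derivation_exp_subst (D : PowerSeries S →+ PowerSeries S)
    (hD : ∀ f g, D (f * g) = f * D g + g * D f) {a : PowerSeries S} (ha : constantCoeff a = 0) :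
    D ((exp S).subst a) = (exp S).subst a * D a := by
  ext n
  -- `D` may lower the order in `X` by one, so that one more term is kept inside `D`.
  obtain ⟨r, hr⟩ := X_pow_dvd_exp_subst_sub ha (n + 2)
  obtain ⟨r', hr'⟩ := X_pow_dvd_exp_subst_sub ha (n + 1)
  have hdvd : (X : PowerSeries S) ^ (n + 1) ∣ D ((exp S).subst a) - (exp S).subst a * D a := by
    have h1 : D ((exp S).subst a) = D (X ^ (n + 2) * r) +
        (∑ k ∈ Finset.range (n + 1), (1 / (k.factorial : ℚ)) • a ^ k) * D a := by
      rw [← hr, map_sub, sub_add, eq_comm, sub_eq_self, sub_eq_zero, map_sum,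
        Finset.sum_range_succ', Finset.sum_mul]
      have hQ (q : ℚ) (f : PowerSeries S) : D (q • f) = q • D f := map_rat_smul D q f
      rw [hQ, pow_zero, Wave.leibniz_one D hD, smul_zero, add_zero]
      refine Finset.sum_congr rfl fun k _ => ?_
      rw [hQ, Wave.leibniz_pow D hD, add_tsub_cancel_right, mul_assoc, ← nsmul_eq_mul,
        ← Nat.cast_smul_eq_nsmul ℚ, smul_smul, smul_mul_assoc, Nat.factorial_succ]
      congr 1
      have := Nat.factorial_ne_zero k
      push_cast
      field_simp
    have h2 : (exp S).subst a * D a = X ^ (n + 1) * r' * D a +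
        (∑ k ∈ Finset.range (n + 1), (1 / (k.factorial : ℚ)) • a ^ k) * D a := by
      rw [← hr']; ring
    rw [h1, h2, add_sub_add_right_eq_sub, hD, Wave.leibniz_pow D hD,
      show n + 2 - 1 = n + 1 by rfl]
    refine ⟨X * D r + r * (((n + 2 : ℕ) : PowerSeries S) * D X) - r' * D a, ?_⟩
    ring
  have := X_pow_dvd_iff.1 hdvd n (by omega)
  rwa [map_sub, sub_eq_zero] at this

end PowerSeries

/-! ### The derivation `d/dλ` and the shift `λ ↦ λ + ε` -/

namespace Wave

variable {R : Type*} [CommRing R]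

@[simp]
theorem coeff_laurentMk (f : ℤ → R) (hf : ∃ N : ℤ, ∀ p < N, f p = 0) (p : ℤ) :
    (laurentMk f hf).coeff p = f p := rfl

theorem coeff_symbol (P : PsiDO R) (p : ℤ) : (symbol P).coeff p = P.coeff (-p) := rfl

theorem coeff_reflect (f : LaurentSeries R) (p : ℤ) :
    (reflect f).coeff p = (Int.negOnePow p : ℤ) • f.coeff p := rfl

theorem coeff_deriv_laurentSeries [Differential R] (f : LaurentSeries R) (p : ℤ) :
    (Differential.deriv f).coeff p = Differential.deriv (f.coeff p) := rfl

theorem coeff_deriv_powerSeries [Differential R] (f : PowerSeries R) (n : ℕ) :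
    PowerSeries.coeff n (Differential.deriv f) = Differential.deriv (PowerSeries.coeff n f) :=
  PowerSeries.coeff_mk n fun n => dHom R (PowerSeries.coeff n f)

theorem coeff_lam_mul (f : LaurentSeries R) (p : ℤ) :
    (lam * f).coeff p = f.coeff (p + 1) := by
  rw [lam, mul_comm, HahnSeries.coeff_mul_single, mul_one, sub_neg_eq_add]

/-- The additive map `λ d/dλ` on `R((λ⁻¹))`. -/
def eulerLamHom : LaurentSeries R →+ LaurentSeries R where
  toFun f := laurentMk (fun p => -(p : R) * f.coeff p) (by
    obtain ⟨N, hN⟩ := laurent_bdd f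
    exact ⟨N, fun p hp => by rw [hN p hp, mul_zero]⟩)
  map_zero' := by ext p; simp
  map_add' f g := by ext p; simp [mul_add]

theorem coeff_eulerLamHom (f : LaurentSeries R) (p : ℤ) :
    (eulerLamHom f).coeff p = -(p : R) * f.coeff p := rfl

theorem eulerLamHom_mul (f g : LaurentSeries R) :
    eulerLamHom (f * g) = f * eulerLamHom g + g * eulerLamHom f := by
  ext p
  have hsub (f : LaurentSeries R) : (eulerLamHom f).support ⊆ f.support := by
    intro q hq h0
    exact hq (by rw [coeff_eulerLamHom, h0, mul_zero])
  rw [HahnSeries.coeff_add, mul_comm g, HahnSeries.coeff_mul_left' f.isPWO_support (hsub f),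
    HahnSeries.coeff_mul_right' g.isPWO_support (hsub g), coeff_eulerLamHom, HahnSeries.coeff_mul,
    Finset.mul_sum, ← Finset.sum_add_distrib]
  refine Finset.sum_congr rfl fun ij hij => ?_
  rw [← (Finset.mem_antidiagonal.1 hij).2.2]
  simp only [coeff_eulerLamHom]
  push_cast
  ring

/-- The derivation `d/dλ = λ⁻¹ (λ d/dλ)` on `R((λ⁻¹))`. -/
def derivLam : LaurentSeries R →+ LaurentSeries R :=
  (AddMonoidHom.mulLeft (HahnSeries.single (1 : ℤ) (1 : R))).comp eulerLamHom

theorem derivLam_mul (f g : LaurentSeries R) :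
    derivLam (f * g) = f * derivLam g + g * derivLam f := by
  change HahnSeries.single (1 : ℤ) (1 : R) * eulerLamHom (f * g) =
    f * (HahnSeries.single (1 : ℤ) (1 : R) * eulerLamHom g) +
    g * (HahnSeries.single (1 : ℤ) (1 : R) * eulerLamHom f)
  rw [eulerLamHom_mul]
  ring

theorem coeff_derivLam (f : LaurentSeries R) (p : ℤ) :
    (derivLam f).coeff p = (1 - p) * f.coeff (p - 1) := by
  change (HahnSeries.single (1 : ℤ) (1 : R) * eulerLamHom f).coeff p = _
  rw [mul_comm, HahnSeries.coeff_mul_single, mul_one, coeff_eulerLamHom]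
  push_cast
  ring

/-- The derivation `d/dλ`, with `ε` constant, on power series in `ε` over `R((λ⁻¹))`. -/
def derivLamSeries : PowerSeries (LaurentSeries R) →+ PowerSeries (LaurentSeries R) :=
  @dHom _ _ (@instDifferentialPowerSeries (LaurentSeries R) _
    (mkDifferential derivLam derivLam_mul))

theorem derivLamSeries_mul (f g : PowerSeries (LaurentSeries R)) :
    derivLamSeries (f * g) = f * derivLamSeries g + g * derivLamSeries f :=
  @dHom_mul _ _ (@instDifferentialPowerSeries (LaurentSeries R) _
    (mkDifferential derivLam derivLam_mul)) f g

theorem coeff_derivLamSeries (f : PowerSeries (LaurentSeries R)) (n : ℕ) :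
    PowerSeries.coeff n (derivLamSeries f) = derivLam (PowerSeries.coeff n f) :=
  PowerSeries.coeff_mk n fun n => derivLam (PowerSeries.coeff n f)

theorem derivLamSeries_C (f : LaurentSeries R) :
    derivLamSeries (PowerSeries.C f) = PowerSeries.C (derivLam f) := by
  ext1 n
  rw [coeff_derivLamSeries, PowerSeries.coeff_C, PowerSeries.coeff_C]
  split_ifs <;> simp

theorem coeff_shift (f : LaurentSeries R) (m : ℕ) (p : ℤ) :
    (PowerSeries.coeff m (shift f)).coeff p =
      Ring.choose ((m : ℤ) - p) m • f.coeff (p - m) := by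
  rw [shift, PowerSeries.coeff_mk, coeff_laurentMk]

theorem coeff_zero_shift (f : LaurentSeries R) : PowerSeries.coeff 0 (shift f) = f := by
  ext p
  rw [coeff_shift]
  simp

/-- The Taylor shift `λ ↦ λ + ε` satisfies `d/dε = d/dλ`. -/
theorem derivative_shift (f : LaurentSeries R) :
    PowerSeries.derivative _ (shift f) = derivLamSeries (shift f) := by
  ext m p
  have h := Ring.choose_smul_choose (((m + 1 : ℕ) : ℤ) - p) (Nat.le_succ m)
  rw [Nat.choose_succ_self_right, show m.succ - m = 1 by omega, Ring.choose_one_right] at h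
  rw [PowerSeries.coeff_derivative, coeff_derivLamSeries, coeff_derivLam, coeff_shift,
    show (PowerSeries.coeff (m + 1) (shift f)) * ((m : LaurentSeries R) + 1) =
      (m + 1) • PowerSeries.coeff (m + 1) (shift f) by rw [nsmul_eq_mul, mul_comm]; push_cast; rfl,
    HahnSeries.coeff_smul, coeff_shift, ← smul_assoc, h,
    show p - ((m + 1 : ℕ) : ℤ) = p - 1 - m by push_cast; ring,
    show ((m + 1 : ℕ) : ℤ) - p = m - (p - 1) by push_cast; ring]
  simp only [zsmul_eq_mul]
  push_cast
  ring

variable [Algebra ℚ R]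

/-- For `F(λ,ε) = f(λ + ε) e^{g(λ+ε) - g(λ)}`, the equation `dF/dε = dF/dλ + g′(λ) F` determines
the coefficients of `F` recursively. -/
theorem coeff_succ_shift_mul_exp (f g : LaurentSeries R)
    (hg : PowerSeries.constantCoeff (shift g - PowerSeries.C g) = 0) (m : ℕ) :
    let F := shift f * (PowerSeries.exp (LaurentSeries R)).subst (shift g - PowerSeries.C g)
    (m + 1) • PowerSeries.coeff (m + 1) F =
      derivLam (PowerSeries.coeff m F) + derivLam g * PowerSeries.coeff m F := by
  intro F
  have hE := PowerSeries.derivation_exp_subst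
    (PowerSeries.derivative (LaurentSeries R)).toLinearMap.toAddMonoidHom
    (PowerSeries.derivative (LaurentSeries R)).leibniz hg
  have hE' := PowerSeries.derivation_exp_subst derivLamSeries derivLamSeries_mul hg
  change PowerSeries.derivative _ _ = _ * PowerSeries.derivative _ _ at hE
  have key : PowerSeries.derivative _ F =
      derivLamSeries F + PowerSeries.C (derivLam g) * F := by
    rw [Derivation.leibniz, derivLamSeries_mul, hE, hE', map_sub, map_sub, derivative_shift,
      derivative_shift, derivLamSeries_C, PowerSeries.derivative_C]
    simp only [smul_eq_mul, F]
    ring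
  have := congrArg (PowerSeries.coeff m) key
  rw [PowerSeries.coeff_derivative, map_add, PowerSeries.coeff_C_mul, coeff_derivLamSeries] at this
  rw [← this, nsmul_eq_mul, mul_comm]
  push_cast
  rfl

end Wave

/-! ### Products with powers of `∂` and formal adjoints -/

namespace PsiDO

variable {R : Type*} [CommRing R] [Differential R]

/-- `P Q = ∑ i, p_i (∂ ^ i Q)`, coefficient by coefficient. -/
theorem coeff_mul_eq_sum_coeff_D_zpow_mul {P Q : PsiDO R} {a b : ℤ} (hP : P.OrderLE a)
    (hQ : Q.OrderLE b) (s : ℤ) (I : Finset ℤ) (hI : ∀ i, s - b ≤ i → i ≤ a → i ∈ I) :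
    (P * Q).coeff s = ∑ i ∈ I, P.coeff i * (single i 1 * Q).coeff s := by
  rw [coeff_mul_eq_sum hP hQ s I (a + b - s + 1).toNat hI (by omega)]
  refine Finset.sum_congr rfl fun i _ => ?_
  by_cases hi : i ≤ a
  · rw [coeff_single_mul i 1 hQ s (a + b - s + 1).toNat (by omega), Finset.mul_sum]
    refine Finset.sum_congr rfl fun k _ => ?_
    rw [mulTerm, one_mul, mul_smul_comm]
  · simp [mulTerm, hP i (by omega)]

theorem iterD_eq_zero {a : R} (ha : Differential.deriv (Differential.deriv a) = 0) (k : ℕ) :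
    iterD (k + 2) a = 0 := by
  induction k with
  | zero => rw [iterD_succ, iterD_succ, iterD_zero, ha]
  | succ k ih => rw [iterD_succ, ih, map_zero]

/-- If `a″ = 0`, the Leibniz rule `∂ ^ i a = a ∂ ^ i + i a′ ∂ ^ (i - 1)` has only two terms. -/
theorem D_zpow_mul_single (i j : ℤ) {a : R}
    (ha : Differential.deriv (Differential.deriv a) = 0) :
    single i 1 * single j a = single (i + j) a + i • single (i + j - 1) (Differential.deriv a) := by
  ext s
  rw [coeff_single_mul i 1 (orderLE_single j a) s ((i + j - s).toNat + 2) (by omega),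
    Finset.sum_range_succ', Finset.sum_range_succ', Finset.sum_eq_zero, coeff_add,
    show (i • single (i + j - 1) (Differential.deriv a)).coeff s =
      i • (single (i + j - 1) (Differential.deriv a)).coeff s from map_zsmul (coeffHom s) _ _]
  · simp only [coeff_single, iterD_zero, iterD_succ, Ring.choose_zero_right, zero_add,
      Ring.choose_one_right, one_mul, one_smul, add_comm (i • _)]
    congr 1
    · exact if_congr (by push_cast; omega) rfl rfl
    · rw [apply_ite (Differential.deriv : R → R), map_zero]
      congr 1
      exact if_congr (by push_cast; omega) rfl rfl
  · intro k _
    rw [coeff_single]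
    split_ifs
    · rw [show k + 1 + 1 = k + 2 from rfl, iterD_eq_zero ha]; simp
    · simp

theorem coeff_mul_single (X : PsiDO R) (j : ℤ) {a : R}
    (ha : Differential.deriv (Differential.deriv a) = 0) (s : ℤ) :
    (X * single j a).coeff s =
      X.coeff (s - j) * a + (s - j + 1) * X.coeff (s - j + 1) * Differential.deriv a := by
  obtain ⟨d, hd⟩ := X.exists_orderLE
  rw [coeff_mul_eq_sum_coeff_D_zpow_mul hd (orderLE_single j a) s
    ({s - j, s - j + 1} ∪ Finset.Icc (s - j) d)
    (fun i h1 h2 => Finset.mem_union_right _ (Finset.mem_Icc.2 ⟨h1, h2⟩))]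
  have h (i : ℤ) : X.coeff i * (single i 1 * single j a).coeff s =
      (if i = s - j then X.coeff i * a else 0) +
      (if i = s - j + 1 then i * X.coeff i * Differential.deriv a else 0) := by
    rw [D_zpow_mul_single i j ha, coeff_add,
      show (i • single (i + j - 1) (Differential.deriv a)).coeff s =
        i • (single (i + j - 1) (Differential.deriv a)).coeff s from map_zsmul (coeffHom s) _ _,
      coeff_single, coeff_single, mul_add, if_congr (show s = i + j ↔ i = s - j by omega) rfl rfl,
      if_congr (show s = i + j - 1 ↔ i = s - j + 1 by omega) rfl rfl, zsmul_eq_mul]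
    congr 1
    · split_ifs <;> simp
    · split_ifs
      · ring
      · simp
  simp only [h]
  rw [Finset.sum_add_distrib, Finset.sum_ite_eq', Finset.sum_ite_eq', if_pos (by simp),
    if_pos (by simp)]
  push_cast
  rfl

theorem coeff_single_mul' (i : ℤ) (a : R) (Q : PsiDO R) (s : ℤ) :
    (single i a * Q).coeff s = a * (single i 1 * Q).coeff s := by
  have h : single i a = single 0 a * single i 1 := by
    ext s; rw [coeff_C_mul]; simp [coeff_single]
  rw [h, mul_assoc, coeff_C_mul]

/-- `Y` is the formal adjoint of `X`, expressed by residues: the coefficient of `∂⁻¹` in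
`∂ ^ (p - 1) Y` is `(-1) ^ p` times the coefficient of `∂ ^ (-p)` in `X`. Since
`X ↦ X^*` is an involution, this says that `Y^* = X`; in this form it enters the computation of
residues directly. -/
def IsFormalAdjoint (X Y : PsiDO R) : Prop :=
  ∀ p : ℤ, (single (p - 1) 1 * Y).coeff (-1) = (Int.negOnePow p : ℤ) • X.coeff (-p)

theorem iterD_iterD (k l : ℕ) (a : R) : iterD k (iterD l a) = iterD (k + l) a := by
  simp [iterD, pow_add]

theorem coeff_adjoint {P : PsiDO R} {a : ℤ} (hP : P.OrderLE a) (s : ℤ) (K : ℕ) (hK : a - s < K) :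
    P.adjoint.coeff s = ∑ k ∈ Finset.range K,
      ((Int.negOnePow (s + k) : ℤ) * Ring.choose (s + k) k) • iterD k (P.coeff (s + k)) := by
  refine finsum_eq_sum_of_support_subset _ fun k hk => ?_
  rw [Finset.coe_range, Set.mem_Iio]
  by_contra h
  exact hk (by simp only [hP (s + k) (by omega), map_zero, smul_zero])

theorem choose_natCast_sub_one (m : ℕ) : Ring.choose ((m : ℤ) - 1) m = if m = 0 then 1 else 0 := by
  cases m with
  | zero => simp
  | succ m =>
    rw [if_neg (by omega), show ((m + 1 : ℕ) : ℤ) - 1 = (m : ℕ) by push_cast; ring,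
      Ring.choose_natCast, Nat.choose_eq_zero_of_lt (by omega), Nat.cast_zero]

/-- Written out, this is the statement that the formal adjoint is an involution; the coefficient of
`iterD m` is a Vandermonde sum equal to `(m - 1).choose m`, which vanishes unless `m = 0`. -/
theorem isFormalAdjoint_adjoint (X : PsiDO R) : IsFormalAdjoint X X.adjoint := by
  intro p
  obtain ⟨a, ha⟩ := X.exists_orderLE
  -- Terms with `k + l ≥ K` vanish, so the double sum over `k` and `l` runs over a triangle and can
  -- be rearranged along the diagonals `k + l = m`.
  let K := (p + a + 1).toNat
  have hterm (k : ℕ) (hk : k ∈ Finset.range K) :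
      Ring.choose (p - 1) k • (1 * iterD k (X.adjoint.coeff (-1 - (p - 1) + k))) =
      ∑ l ∈ Finset.range (K - k), (Ring.choose (p - 1) k * Ring.choose ((k + l : ℕ) - p) l) •
        (Int.negOnePow ((k + l : ℕ) - p) : ℤ) • iterD (k + l) (X.coeff ((k + l : ℕ) - p)) := by
    rw [Finset.mem_range] at hk
    rw [coeff_adjoint ha _ (K - k) (by omega), one_mul, map_sum, Finset.smul_sum]
    refine Finset.sum_congr rfl fun l _ => ?_
    rw [map_zsmul, iterD_iterD, smul_smul, smul_smul,
      show -1 - (p - 1) + (k : ℤ) + l = (k + l : ℕ) - p by push_cast; ring]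
    congr 1
    ring
  rw [coeff_single_mul (p - 1) 1 ha.adjoint (-1) K (by omega), Finset.sum_congr rfl hterm,
    ← Finset.sum_range_diag_flip K fun k l =>
      (Ring.choose (p - 1) k * Ring.choose ((k + l : ℕ) - p) l) •
        (Int.negOnePow ((k + l : ℕ) - p) : ℤ) • iterD (k + l) (X.coeff ((k + l : ℕ) - p))]
  have hdiag (m : ℕ) : ∑ k ∈ Finset.range (m + 1),
      (Ring.choose (p - 1) k * Ring.choose ((k + (m - k) : ℕ) - p) (m - k)) •
        (Int.negOnePow ((k + (m - k) : ℕ) - p) : ℤ) •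
          iterD (k + (m - k)) (X.coeff ((k + (m - k) : ℕ) - p)) =
      if m = 0 then (Int.negOnePow p : ℤ) • X.coeff (-p) else 0 := by
    have h : ∑ k ∈ Finset.range (m + 1), Ring.choose (p - 1) k * Ring.choose (m - p) (m - k) =
        if m = 0 then 1 else 0 := by
      rw [← choose_natCast_sub_one, show (m : ℤ) - 1 = (p - 1) + (m - p) by ring,
        Ring.add_choose_eq _ (Commute.all _ _), Finset.Nat.sum_antidiagonal_eq_sum_range_succ_mk]
    have h' (k : ℕ) (hk : k ∈ Finset.range (m + 1)) : k + (m - k) = m := by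
      rw [Finset.mem_range] at hk; omega
    rw [Finset.sum_congr rfl fun k hk => by rw [h' k hk], ← Finset.sum_smul, h]
    split_ifs with hm
    · subst hm; simp [iterD_zero, Int.negOnePow_neg]
    · rw [zero_smul]
  simp only [hdiag]
  rw [Finset.sum_ite_eq']
  split_ifs with h0
  · rfl
  · rw [ha (-p) (by simp at h0; omega), smul_zero]

end PsiDO

/-! ### Multiplication by `Γ` -/

namespace Wave

open PsiDO

variable {R : Type*} [CommRing R]

theorem derivLam_xi (τ : ℕ →₀ R) :
    derivLam (xi τ) = ∑ i ∈ τ.support, HahnSeries.single (-(2 * (i : ℤ))) ((2 * i + 1) • τ i) := by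
  rw [xi, Finsupp.sum, map_sum]
  refine Finset.sum_congr rfl fun i _ => ?_
  ext p
  rw [coeff_derivLam, HahnSeries.coeff_single, HahnSeries.coeff_single]
  by_cases h : p = -(2 * (i : ℤ))
  · rw [if_pos (by omega), if_pos h, h, nsmul_eq_mul]
    push_cast
    ring
  · rw [if_neg (by omega), if_neg h, mul_zero]

variable [Differential R]

section Gam

variable {τ : ℕ →₀ R}

/-- Only `τ 0 = x` depends on `x`. If `0` is not in the support of `τ`, then `τ 0 = 0` together with
`(τ 0)′ = 1` makes `R` trivial, and the formula persists. -/
theorem sum_support_of_deriv (h0 : Differential.deriv (τ 0) = 1)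
    (hs : ∀ i, i ≠ 0 → Differential.deriv (τ i) = 0) (f : ℕ → R) :
    ∑ i ∈ τ.support, f i * Differential.deriv ((2 * i + 1) • τ i) = f 0 := by
  rw [Finset.sum_eq_single 0]
  · simp [h0]
  · intro i _ hi
    rw [map_nsmul (Differential.deriv : Derivation ℤ R R), hs i hi, smul_zero, mul_zero]
  · intro h
    rw [Finsupp.notMem_support_iff.1 h, smul_zero, map_zero, mul_zero]

theorem deriv_deriv_time (h0 : Differential.deriv (τ 0) = 1)
    (hs : ∀ i, i ≠ 0 → Differential.deriv (τ i) = 0) (i n : ℕ) :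
    Differential.deriv (Differential.deriv (n • τ i)) = 0 := by
  have h1 : Differential.deriv (1 : R) = 0 :=
    (Differential.deriv : Derivation ℤ R R).map_one_eq_zero
  rw [map_nsmul, map_nsmul]
  by_cases h : i = 0
  · rw [h, h0, h1, smul_zero]
  · rw [hs i h, map_zero, smul_zero]

/-- On coefficients, right multiplication by `Γ` is `ξ_λ + d/dλ` acting on symbols. -/
theorem coeff_mul_Gam (h0 : Differential.deriv (τ 0) = 1)
    (hs : ∀ i, i ≠ 0 → Differential.deriv (τ i) = 0) (X : PsiDO R) (s : ℤ) :
    (X * Gam τ).coeff s =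
      ∑ i ∈ τ.support, ((2 * i + 1) • τ i) * X.coeff (s - 2 * i) + (s + 1) * X.coeff (s + 1) := by
  rw [Gam, Finsupp.sum, Finset.mul_sum, coeff_sum]
  simp only [coeff_mul_single X _ (deriv_deriv_time h0 hs _ _)]
  rw [Finset.sum_add_distrib]
  congr 1
  · exact Finset.sum_congr rfl fun i _ => mul_comm _ _
  · rw [sum_support_of_deriv h0 hs fun i =>
      ((s : R) - ((2 * i : ℤ) : R) + 1) * X.coeff (s - 2 * i + 1)]
    simp

theorem coeff_D_zpow_mul_Gam_mul (h0 : Differential.deriv (τ 0) = 1)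
    (hs : ∀ i, i ≠ 0 → Differential.deriv (τ i) = 0) (n : ℤ) (Y : PsiDO R) (s : ℤ) :
    (single n 1 * (Gam τ * Y)).coeff s =
      ∑ i ∈ τ.support, ((2 * i + 1) • τ i) * (single (n + 2 * i) 1 * Y).coeff s +
        n * (single (n - 1) 1 * Y).coeff s := by
  rw [Gam, Finsupp.sum, ← mul_assoc, Finset.mul_sum, Finset.sum_mul, coeff_sum]
  simp only [D_zpow_mul_single _ _ (deriv_deriv_time h0 hs _ _), add_mul, coeff_add, smul_mul_assoc]
  rw [Finset.sum_add_distrib]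
  congr 1
  · exact Finset.sum_congr rfl fun i _ => by rw [coeff_single_mul', smul_mul_assoc]
  · have hz (Z : PsiDO R) : (n • Z).coeff s = n * Z.coeff s := by
      rw [← zsmul_eq_mul]; exact map_zsmul (coeffHom s) n Z
    simp only [hz, coeff_single_mul' _ (Differential.deriv _)]
    have h := sum_support_of_deriv h0 hs fun i =>
      (n : R) * (single (n + 2 * i - 1) 1 * Y).coeff s
    rw [Nat.cast_zero, mul_zero, add_zero] at h
    rw [← h]
    exact Finset.sum_congr rfl fun i _ => by ring

/-- `(X Γ)^* = Γ X^*`, as `Γ` is formally self-adjoint. -/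
theorem isFormalAdjoint_mul_Gam (h0 : Differential.deriv (τ 0) = 1)
    (hs : ∀ i, i ≠ 0 → Differential.deriv (τ i) = 0) {X Y : PsiDO R} (h : IsFormalAdjoint X Y) :
    IsFormalAdjoint (X * Gam τ) (Gam τ * Y) := by
  intro p
  rw [coeff_D_zpow_mul_Gam_mul h0 hs, coeff_mul_Gam h0 hs, h (p - 1), smul_add, Finset.smul_sum]
  congr 1
  · refine Finset.sum_congr rfl fun i _ => ?_
    rw [show p - 1 + 2 * (i : ℤ) = p + 2 * i - 1 by ring, h, ← mul_smul_comm,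
      Int.negOnePow_add, Int.negOnePow_two_mul, mul_one]
    congr 3
    ring
  · rw [Int.negOnePow_sub, Int.negOnePow_one, show -(p - 1) = -p + 1 by ring]
    simp only [zsmul_eq_mul]
    push_cast
    ring

theorem isFormalAdjoint_mul_Gam_pow (h0 : Differential.deriv (τ 0) = 1)
    (hs : ∀ i, i ≠ 0 → Differential.deriv (τ i) = 0) {X Y : PsiDO R} (h : IsFormalAdjoint X Y)
    (m : ℕ) : IsFormalAdjoint (X * Gam τ ^ m) (Gam τ ^ m * Y) := by
  induction m with
  | zero => simpa using h
  | succ m ih =>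
    have := isFormalAdjoint_mul_Gam h0 hs ih
    rwa [mul_assoc, ← pow_succ, ← mul_assoc, ← pow_succ'] at this

/-- The symbol of `X Γ` is `e^{-ξ} d/dλ (σ e^{ξ})`, where `σ` is the symbol of `X`. -/
theorem symbol_mul_Gam (h0 : Differential.deriv (τ 0) = 1)
    (hs : ∀ i, i ≠ 0 → Differential.deriv (τ i) = 0) (X : PsiDO R) :
    symbol (X * Gam τ) = derivLam (symbol X) + derivLam (xi τ) * symbol X := by
  ext p
  rw [coeff_symbol, coeff_mul_Gam h0 hs, derivLam_xi, Finset.sum_mul, HahnSeries.coeff_add,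
    coeff_derivLam, HahnSeries.coeff_sum, add_comm]
  congr 1
  · rw [coeff_symbol, show -(p - 1) = -p + 1 by ring]
    push_cast
    ring
  · refine Finset.sum_congr rfl fun i _ => ?_
    rw [mul_comm (HahnSeries.single _ _), HahnSeries.coeff_mul_single, coeff_symbol, mul_comm]
    congr 2
    ring

/-- The expansion of the wave function in `ε`: up to `m!`, the coefficient of `ε ^ m` in
`e^{-ξ(λ)} (X e^{ξ})(λ + ε)` is the symbol of `X Γ ^ m`, because both satisfy the recursion given by
`d/dλ + ξ_λ`. -/
theorem factorial_smul_coeff_wave [Algebra ℚ R] (h0 : Differential.deriv (τ 0) = 1)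
    (hs : ∀ i, i ≠ 0 → Differential.deriv (τ i) = 0) (X : PsiDO R) (m : ℕ) :
    m.factorial • PowerSeries.coeff m (shift (symbol X) *
      (PowerSeries.exp (LaurentSeries R)).subst (shift (xi τ) - PowerSeries.C (xi τ))) =
    symbol (X * Gam τ ^ m) := by
  have hc : PowerSeries.constantCoeff (shift (xi τ) - PowerSeries.C (xi τ)) = 0 := by
    rw [map_sub, ← PowerSeries.coeff_zero_eq_constantCoeff_apply, coeff_zero_shift,
      PowerSeries.constantCoeff_C, sub_self]
  induction m with
  | zero =>
    rw [Nat.factorial_zero, one_smul, PowerSeries.coeff_zero_eq_constantCoeff_apply, map_mul,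
      PowerSeries.constantCoeff_exp_subst hc, ← PowerSeries.coeff_zero_eq_constantCoeff_apply,
      coeff_zero_shift, mul_one, pow_zero, mul_one]
  | succ m ih =>
    have h := coeff_succ_shift_mul_exp (symbol X) (xi τ) hc m
    rw [Nat.factorial_succ, mul_comm, mul_smul, h, smul_add, ← map_nsmul, ← mul_smul_comm, ih,
      pow_succ, ← mul_assoc, symbol_mul_Gam h0 hs]

end Gam

end Wave

/-! ### The residue formula -/

namespace Wave

open PsiDO

variable {R : Type*} [CommRing R]

theorem laurent_coeff_mul_eq_sum {f g : LaurentSeries R} {a b : ℤ} (hf : ∀ q < a, f.coeff q = 0)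
    (hg : ∀ q < b, g.coeff q = 0) (p : ℤ) (J : Finset ℤ)
    (hJ : ∀ q, a ≤ q → q ≤ p - b → q ∈ J) :
    (f * g).coeff p = ∑ q ∈ J, f.coeff q * g.coeff (p - q) := by
  rw [HahnSeries.coeff_mul]
  refine Finset.sum_of_injOn Prod.fst ?_ ?_ ?_ ?_
  · rintro ⟨i, j⟩ hi ⟨i', j'⟩ hi' h
    have h1 := (Finset.mem_antidiagonal.1 hi).2.2
    have h2 := (Finset.mem_antidiagonal.1 hi').2.2
    simp only at h h1 h2
    simp only [Prod.mk.injEq]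
    omega
  · rintro ⟨i, j⟩ hij
    obtain ⟨hi, hj, h⟩ := Finset.mem_antidiagonal.1 hij
    simp only at hi hj h
    refine hJ i ?_ ?_
    · by_contra hc
      exact hi (hf i (by omega))
    · by_contra hc
      exact hj (hg j (by omega))
  · intro q _ hq
    by_contra hc
    refine hq ⟨(q, p - q), Finset.mem_antidiagonal.2 ⟨left_ne_zero_of_mul hc,
      right_ne_zero_of_mul hc, by simp⟩, rfl⟩
  · rintro ⟨i, j⟩ hij
    have h := (Finset.mem_antidiagonal.1 hij).2.2
    simp only at h ⊢
    rw [← h, add_sub_cancel_left]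

theorem reflect_mul (f g : LaurentSeries R) : reflect (f * g) = reflect f * reflect g := by
  ext p
  obtain ⟨a, ha⟩ := laurent_bdd f
  obtain ⟨b, hb⟩ := laurent_bdd g
  have hJ : ∀ q, a ≤ q → q ≤ p - b → q ∈ Finset.Icc a (p - b) :=
    fun q h1 h2 => Finset.mem_Icc.2 ⟨h1, h2⟩
  rw [coeff_reflect, laurent_coeff_mul_eq_sum ha hb p _ hJ,
    laurent_coeff_mul_eq_sum (f := reflect f) (g := reflect g)
      (fun q hq => by rw [coeff_reflect, ha q hq, smul_zero])
      (fun q hq => by rw [coeff_reflect, hb q hq, smul_zero]) p _ hJ, Finset.smul_sum]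
  refine Finset.sum_congr rfl fun q _ => ?_
  rw [coeff_reflect, coeff_reflect, smul_mul_smul_comm, ← Units.val_mul, ← Int.negOnePow_add,
    add_sub_cancel]

theorem reflect_reflect (f : LaurentSeries R) : reflect (reflect f) = f := by
  ext p
  rw [coeff_reflect, coeff_reflect, smul_smul, ← Units.val_mul, ← Int.negOnePow_add,
    Int.negOnePow_even _ (Even.add_self p), Units.val_one, one_smul]

variable [Differential R]

/-- The operator `f ↦ e^{-c ξ(t,λ)} ∂ (f e^{c ξ(t,λ)}) = f′ + c λ f` on `R((λ⁻¹))`. -/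
def twistedD (c : ℤ) : LaurentSeries R →+ LaurentSeries R where
  toFun f := Differential.deriv f + c • (lam * f)
  map_zero' := by simp
  map_add' f g := by rw [map_add, mul_add, smul_add]; abel

theorem twistedD_apply (c : ℤ) (f : LaurentSeries R) :
    twistedD c f = Differential.deriv f + c • (lam * f) := rfl

theorem coeff_twistedD (c : ℤ) (f : LaurentSeries R) (p : ℤ) :
    (twistedD c f).coeff p = Differential.deriv (f.coeff p) + c • f.coeff (p + 1) := by
  rw [twistedD_apply, HahnSeries.coeff_add, HahnSeries.coeff_smul, coeff_lam_mul,
    coeff_deriv_laurentSeries]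

theorem reflect_twistedD (c : ℤ) (f : LaurentSeries R) :
    reflect (twistedD c f) = twistedD (-c) (reflect f) := by
  ext p
  rw [coeff_reflect, coeff_twistedD, coeff_twistedD, coeff_reflect, coeff_reflect, smul_add,
    map_zsmul, Int.negOnePow_succ]
  simp only [zsmul_eq_mul]
  push_cast
  ring

theorem reflect_iterate_twistedD (c : ℤ) (k : ℕ) (f : LaurentSeries R) :
    reflect ((twistedD c)^[k] f) = (twistedD (-c))^[k] (reflect f) := by
  induction k with
  | zero => rfl
  | succ k ih => rw [Function.iterate_succ_apply', Function.iterate_succ_apply', reflect_twistedD,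
      ih]

theorem deriv_C_mul_T (f : PowerSeries (LaurentSeries R)) (c : ℤ) :
    Differential.deriv (LaurentPolynomial.C f * LaurentPolynomial.T c : WaveRing R) =
      LaurentPolynomial.C (PowerSeries.mk fun m => twistedD c (PowerSeries.coeff m f)) *
        LaurentPolynomial.T c := by
  have h : (PowerSeries.mk fun m => twistedD c (PowerSeries.coeff m f)) =
      Differential.deriv f + (c : PowerSeries (LaurentSeries R)) * PowerSeries.C lam * f := by
    ext1 m
    rw [PowerSeries.coeff_mk, map_add, mul_assoc, ← zsmul_eq_mul, map_zsmul,
      PowerSeries.coeff_C_mul, coeff_deriv_powerSeries, twistedD_apply]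
  rw [h, ← LaurentPolynomial.single_eq_C_mul_T, ← LaurentPolynomial.single_eq_C_mul_T]
  ext k : 1
  change dHom (PowerSeries (LaurentSeries R)) _ + _ = _
  simp only [Finsupp.onFinset_apply, AddMonoidAlgebra.coeff_single, Finsupp.single_apply]
  split_ifs with hk
  · rw [hk]; rfl
  · simp

/-- `∂ ^ k (f e^{c ξ})` is `e^{c ξ}` times the `k`-th iterate of `∂ + c λ` applied to `f`. -/
theorem iterD_C_mul_T (f : PowerSeries (LaurentSeries R)) (c : ℤ) (k : ℕ) :
    iterD k (LaurentPolynomial.C f * LaurentPolynomial.T c : WaveRing R) =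
      LaurentPolynomial.C (PowerSeries.mk fun m => (twistedD c)^[k] (PowerSeries.coeff m f)) *
        LaurentPolynomial.T c := by
  induction k with
  | zero =>
    rw [iterD_zero]
    congr 2
    ext1 m
    simp
  | succ k ih =>
    rw [iterD_succ, ih, deriv_C_mul_T]
    congr 2
    ext1 m
    simp only [PowerSeries.coeff_mk, Function.iterate_succ_apply']

/-- For `Y = X^*`, the series `(λ - ∂) ^ k (σ(X)(-λ))` is `∑ p, λ ^ (-p) c_p`, where `c_p` is the
coefficient of `∂ ^ (-1 - k)` in `∂ ^ (p - 1) Y`. The induction on `k` compares coefficients in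
`∂ (∂ ^ (p - 1) Y) = ∂ ^ p Y`. -/
theorem coeff_twistedD_iterate_reflect_symbol {X Y : PsiDO R} (h : IsFormalAdjoint X Y) (k : ℕ)
    (p : ℤ) :
    ((-1 : ℤ) ^ k • (twistedD (-1))^[k] (reflect (symbol X))).coeff p =
      (single (p - 1) 1 * Y).coeff (-1 - k) := by
  induction k generalizing p with
  | zero =>
    rw [pow_zero, one_smul, Function.iterate_zero, id, coeff_reflect, coeff_symbol, ← h]
    congr 1
  | succ k ih =>
    have hD := coeff_D_mul (single (p - 1) 1 * Y) (-1 - k)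
    rw [← mul_assoc, single_one_mul_single_one, add_sub_cancel, ← ih, show p = p + 1 - 1 by ring,
      ← ih, add_sub_cancel_right] at hD
    rw [show -1 - ((k + 1 : ℕ) : ℤ) = -1 - k - 1 by push_cast; ring, eq_sub_of_add_eq hD.symm,
      Function.iterate_succ_apply']
    simp only [HahnSeries.coeff_smul, coeff_twistedD, map_zsmul, pow_succ]
    simp only [zsmul_eq_mul]
    push_cast
    ring

/-- The coefficientwise form of
`∑ n, λ ^ (-n - 1) (P ∂ ^ n Y)_- = (P e^{ξ}) ∂⁻¹ (Y^* e^{-ξ})`, with `Y = X^*` and `n = p - 1`. -/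
theorem coeff_symbol_mul_twistedD_iterate (P : PsiDO R) {X Y : PsiDO R} (h : IsFormalAdjoint X Y)
    (k : ℕ) (p : ℤ) :
    ((-1 : ℤ) ^ k • (symbol P * (twistedD (-1))^[k] (reflect (symbol X)))).coeff p =
      (P * single (p - 1) 1 * Y).coeff (-1 - k) := by
  obtain ⟨a, ha⟩ := P.exists_orderLE
  obtain ⟨b, hb⟩ := Y.exists_orderLE
  obtain ⟨c, hc⟩ := laurent_bdd ((-1 : ℤ) ^ k • (twistedD (-1))^[k] (reflect (symbol X)))
  -- The index `i` of a coefficient of `P` corresponds to the index `-i` of its symbol.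
  rw [← mul_smul_comm, laurent_coeff_mul_eq_sum (a := -a) (fun q hq => ha _ (by omega)) hc p
      ((Finset.Icc (min (c - p) (-1 - k - (p - 1 + b))) a).map (Equiv.neg ℤ).toEmbedding)
      (fun q h1 h2 => by
        rw [Finset.mem_map_equiv, Finset.mem_Icc]
        simp only [Equiv.neg_symm, Equiv.neg_apply]
        omega),
    Finset.sum_map, mul_assoc,
    coeff_mul_eq_sum_coeff_D_zpow_mul ha ((orderLE_single (p - 1) 1).mul hb) _
      (Finset.Icc (min (c - p) (-1 - k - (p - 1 + b))) a)
      (fun i h1 h2 => Finset.mem_Icc.2 (by omega))]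
  refine Finset.sum_congr rfl fun i _ => ?_
  rw [coeff_twistedD_iterate_reflect_symbol h, ← mul_assoc, single_one_mul_single_one]
  simp only [Equiv.coe_toEmbedding, Equiv.neg_apply, coeff_symbol, neg_neg]
  congr 4
  ring

end Wave

/-! ### The generating function over a differential ring -/

namespace Wave

open PsiDO

section Operators

variable {S : Type*} [CommRing S] [Differential S]

theorem coeff_mul_D_inv_mul_of_nonneg (f g : S) {j : ℤ} (hj : 0 ≤ j) :
    (single 0 f * single (-1) 1 * single 0 g).coeff j = 0 := by
  have h := ((orderLE_single 0 f).mul (orderLE_single (-1) (1 : S))).mul (orderLE_single 0 g)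
  exact h j (by omega)

theorem coeff_mul_D_inv_mul (f g : S) (k : ℕ) :
    (single 0 f * single (-1) 1 * single 0 g).coeff (-1 - k) =
      (-1 : ℤ) ^ k • (f * iterD k g) := by
  have hc : Ring.choose (-1 : ℤ) k = (-1) ^ k := by
    have h := Ring.choose_neg' (1 : ℤ) k
    rw [Ring.multichoose_one] at h
    rw [h, Units.smul_def, smul_eq_mul, mul_one, Int.coe_negOnePow_natCast]
  rw [mul_assoc, coeff_C_mul, coeff_single_mul (-1) 1 (orderLE_single 0 g) _ (k + 1)
      (by push_cast; omega),
    Finset.sum_range_succ, Finset.sum_eq_zero, zero_add, hc, coeff_single, if_pos (by ring),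
    one_mul, mul_smul_comm]
  intro l hl
  rw [Finset.mem_range] at hl
  rw [coeff_single, if_neg (by omega), map_zero, mul_zero, smul_zero]

end Operators

variable {R : Type*} [CommRing R] [Differential R]

namespace WaveOp

variable (W : WaveOp R) (τ : ℕ →₀ R)

theorem coe_D_zpow (n : ℤ) :
    (((PsiDO.D : (PsiDO R)ˣ) ^ n : (PsiDO R)ˣ) : PsiDO R) = PsiDO.single n 1 := by
  induction n using Int.induction_on with
  | zero => rfl
  | succ i ih =>
    rw [zpow_add_one, Units.val_mul, ih]
    exact PsiDO.single_one_mul_single_one _ _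
  | pred i ih =>
    rw [zpow_sub_one, Units.val_mul, ih]
    exact PsiDO.single_one_mul_single_one _ _

theorem coe_L_zpow (n : ℤ) :
    ((W.L ^ n : (PsiDO R)ˣ) : PsiDO R) = W.phi * single n 1 * W.phi.adjoint := by
  rw [L, conj_zpow, Units.val_mul, Units.val_mul, coe_D_zpow]
  rfl

theorem M_pow (m : ℕ) : W.M τ ^ m = W.phi * Gam τ ^ m * W.phi.adjoint :=
  Units.conj_pow W.unit (Gam τ) m

theorem M_pow_mul_L_zpow (m : ℕ) (n : ℤ) :
    W.M τ ^ m * ((W.L ^ n : (PsiDO R)ˣ) : PsiDO R) =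
      W.phi * Gam τ ^ m * single n 1 * W.phi.adjoint := by
  rw [M_pow, coe_L_zpow, mul_assoc, mul_assoc W.phi (single n 1), ← mul_assoc _ W.phi,
    W.adjoint_mul_phi, one_mul, ← mul_assoc]

theorem L_zpow_mul_M_pow (m : ℕ) (n : ℤ) :
    ((W.L ^ n : (PsiDO R)ˣ) : PsiDO R) * W.M τ ^ m =
      W.phi * single n 1 * (Gam τ ^ m * W.phi.adjoint) := by
  rw [M_pow, coe_L_zpow, mul_assoc, mul_assoc W.phi (Gam τ ^ m), ← mul_assoc _ W.phi,
    W.adjoint_mul_phi, one_mul]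

variable {τ}

/-- The operators `φ ∂ ^ (p - 1) Γ ^ m φ^*` in the second half of `A` are handled by the residue
formula with left factor `φ` and with `(Γ ^ m φ^*)^* = φ Γ ^ m`; the sign `(-1) ^ (p - 1)` amounts
to the substitution `λ ↦ -λ`, which interchanges `e^{ξ}` and `e^{-ξ}`. -/
theorem coeff_A (h0 : Differential.deriv (τ 0) = 1)
    (hs : ∀ i, i ≠ 0 → Differential.deriv (τ i) = 0) (m k : ℕ) (p : ℤ) :
    (W.A τ m (p - 1)).coeff (-1 - k) =
      ((-1 : ℤ) ^ k • (symbol (W.phi * Gam τ ^ m) *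
        (twistedD (-1))^[k] (reflect (symbol W.phi)))).coeff p +
      ((-1 : ℤ) ^ k • (reflect (symbol W.phi) *
        (twistedD 1)^[k] (symbol (W.phi * Gam τ ^ m)))).coeff p := by
  have hadj := isFormalAdjoint_adjoint W.phi
  have h1 := coeff_symbol_mul_twistedD_iterate (W.phi * Gam τ ^ m) hadj k p
  have h2 := coeff_symbol_mul_twistedD_iterate W.phi (isFormalAdjoint_mul_Gam_pow h0 hs hadj m) k p
  have h3 : reflect (symbol W.phi * (twistedD (-1))^[k] (reflect (symbol (W.phi * Gam τ ^ m)))) =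
      reflect (symbol W.phi) * (twistedD 1)^[k] (symbol (W.phi * Gam τ ^ m)) := by
    rw [reflect_mul, reflect_iterate_twistedD, reflect_reflect, neg_neg]
  have hA : (W.A τ m (p - 1)).coeff (-1 - k) =
      (W.M τ ^ m * ((W.L ^ (p - 1) : (PsiDO R)ˣ) : PsiDO R)).coeff (-1 - k) -
      (Int.negOnePow (p - 1) : ℤ) •
        (((W.L ^ (p - 1) : (PsiDO R)ˣ) : PsiDO R) * W.M τ ^ m).coeff (-1 - k) := by
    refine (map_sub (coeffHom (R := R) (-1 - k)) _ _).trans ?_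
    rw [map_zsmul]
    rfl
  rw [hA, M_pow_mul_L_zpow, L_zpow_mul_M_pow, ← h3, h1,
    HahnSeries.coeff_smul (r := (-1 : ℤ) ^ k) (x := reflect _), coeff_reflect, smul_comm,
    ← HahnSeries.coeff_smul, h2, Int.negOnePow_sub, Int.negOnePow_one, sub_eq_add_neg, ← neg_smul]
  simp

variable [Algebra ℚ R]

/-- The identity for the generating function holds over every differential `ℚ`-algebra in which
`τ 0 = x` has derivative `1` and the other times are constants. -/
theorem Y_eq (h0 : Differential.deriv (τ 0) = 1)
    (hs : ∀ i, i ≠ 0 → Differential.deriv (τ i) = 0) :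
    W.Y τ = single 0 (W.waveMu τ) * single (-1) 1 * single 0 W.waveNegLam +
      single 0 W.waveNegLam * single (-1) 1 * single 0 (W.waveMu τ) := by
  ext1
  funext j
  rw [coeff_add]
  rcases lt_or_ge j 0 with hj | hj
  · obtain ⟨k, rfl⟩ : ∃ k : ℕ, j = -1 - k := ⟨(-1 - j).toNat, by omega⟩
    -- The exponentials `e^{ξ}` and `e^{-ξ}` cancel in both summands.
    have hT (f g : PowerSeries (LaurentSeries R)) (e : ℤ) :
        (LaurentPolynomial.C f * LaurentPolynomial.T e) *
          (LaurentPolynomial.C g * LaurentPolynomial.T (-e)) = LaurentPolynomial.C (f * g) := by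
      rw [mul_mul_mul_comm, ← LaurentPolynomial.T_add, add_neg_cancel, LaurentPolynomial.T_zero,
        mul_one, map_mul]
    rw [coeff_mul_D_inv_mul, coeff_mul_D_inv_mul, waveMu, waveNegLam, iterD_C_mul_T, iterD_C_mul_T,
      hT, show (LaurentPolynomial.T 1 : WaveRing R) = LaurentPolynomial.T (-(-1)) by rw [neg_neg],
      hT, ← map_zsmul, ← map_zsmul, ← map_add]
    change LaurentPolynomial.C _ = LaurentPolynomial.C _
    congr 1
    ext m p
    have hC : (PowerSeries.mk fun m => (twistedD (-1))^[k]
        (PowerSeries.coeff m (PowerSeries.C (reflect (symbol W.phi))))) =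
        PowerSeries.C ((twistedD (-1))^[k] (reflect (symbol W.phi))) := by
      ext1 n
      rw [PowerSeries.coeff_mk, PowerSeries.coeff_C, PowerSeries.coeff_C]
      split_ifs
      · rfl
      · exact iterate_map_zero _ _
    have hF := factorial_smul_coeff_wave h0 hs W.phi m
    rw [hC, map_add, map_zsmul, map_zsmul, PowerSeries.coeff_mul_C, PowerSeries.coeff_C_mul,
      PowerSeries.coeff_mk, PowerSeries.coeff_mk, coeff_laurentMk]
    set F := shift (symbol W.phi) *
      (PowerSeries.exp (LaurentSeries R)).subst (shift (xi τ) - PowerSeries.C (xi τ))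
    have hA := W.coeff_A h0 hs m k p
    rw [← hF, iterate_map_nsmul, mul_smul_comm, smul_mul_assoc, smul_comm _ m.factorial,
      smul_comm _ m.factorial, ← HahnSeries.coeff_add, ← smul_add, HahnSeries.coeff_smul] at hA
    change algebraMap ℚ R _ * (if _ then _ else _) = _
    rw [if_pos hj, hA, nsmul_eq_mul, ← mul_assoc, ← map_natCast (algebraMap ℚ R), ← map_mul,
      one_div, inv_mul_cancel₀ (by exact_mod_cast m.factorial_ne_zero), map_one, one_mul]
  · rw [coeff_mul_D_inv_mul_of_nonneg _ _ hj, coeff_mul_D_inv_mul_of_nonneg _ _ hj, add_zero]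
    rw [← map_zero LaurentPolynomial.C]
    change LaurentPolynomial.C _ = _
    congr 1
    ext m p
    rw [PowerSeries.coeff_mk, coeff_laurentMk]
    change _ * (if j < 0 then _ else _) = _
    rw [if_neg (by omega), mul_zero]
    simp

end WaveOp

end Wave

/-! ### Smooth functions -/

namespace CKP

open scoped ContDiff

variable {𝕜 𝕂 : Type*} [RCLike 𝕜] [RCLike 𝕂] [NormedAlgebra 𝕜 𝕂]

theorem deriv_smoothMk {V : TopologicalSpace.Opens 𝕜} (f : 𝕜 → 𝕂) (hf : ContDiffOn 𝕜 ∞ f V)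
    (x : V) : (Differential.deriv (smoothMk f hf)).1 x = deriv f x := by
  change deriv (ext0 (smoothMk f hf).1) x = _
  refine Filter.EventuallyEq.deriv_eq ?_
  filter_upwards [V.isOpen.mem_nhds x.2] with y hy
  exact ext0_apply _ ⟨y, hy⟩

theorem deriv_timeFunctions_zero (U : TimeDomain 𝕜) (t : Times 𝕜) :
    Differential.deriv (timeFunctions 𝕂 U t 0) = 1 := by
  ext x
  rw [timeFunctions, Finsupp.update_apply, if_pos rfl]
  refine (deriv_smoothMk (fun x => algebraMap 𝕜 𝕂 x)
    (algebraMapCLM 𝕜 𝕂).contDiff.contDiffOn x).trans ?_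
  exact (algebraMapCLM 𝕜 𝕂).hasDerivAt.deriv.trans (map_one (algebraMap 𝕜 𝕂))

theorem deriv_timeFunctions_of_ne_zero (U : TimeDomain 𝕜) (t : Times 𝕜) {i : ℕ} (hi : i ≠ 0) :
    Differential.deriv (timeFunctions 𝕂 U t i) = 0 := by
  ext x
  rw [timeFunctions, Finsupp.update_apply, if_neg hi]
  exact (deriv_smoothMk (fun _ => algebraMap 𝕜 𝕂 (t i)) contDiffOn_const x).trans
    (deriv_const _ _)

end CKP

end

theorem mainTheorem4 {𝕜 𝕂 : Type*} [RCLike 𝕜] [RCLike 𝕂] [NormedAlgebra 𝕜 𝕂]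
    (U : CKP.TimeDomain 𝕜) (Φ : CKP.Dressing 𝕂 U) (hΦ : Φ.IsCKP)
    (t : CKP.Times 𝕜) (ht : t ∈ U.carrier) :
    Φ.generatingFunction t =
      PsiDO.single 0 (Φ.waveMu t) * PsiDO.single (-1) 1 * PsiDO.single 0 (Φ.waveNegLam t) +
      PsiDO.single 0 (Φ.waveNegLam t) * PsiDO.single (-1) 1 * PsiDO.single 0 (Φ.waveMu t) := by
  exact (Φ.waveOp t).Y_eq (CKP.deriv_timeFunctions_zero U t)
    fun _ hi => CKP.deriv_timeFunctions_of_ne_zero U t hi
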